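/- **Theorem (iteration lower bound, convex case).** Let $d\ge 3$ and $T\ge 2$ be integers and let $L,D,\varepsilon>0$; put $R=D/2$ and $\mathcal X=\{x\in\mathbb R^d:\|x\|\le R\}$ (Euclidean norm). Then there is a problem of the following form. *Data.* Constants $L/2\le L_T<L_{T-1}<\dots<L_1\le L$; for each $t=1,\dots,T-1$, with $\beta_t=\frac{\varepsilon}{(T-1)L_{t+1}}$, distinct points $w_{t,1},\dots,w_{t,K_t}$ ($K_t\ge1$) of the sphere of radius $R$ in $\mathbb R^d$ such that no $w_{t,l}$, $l\ne k$, lies in the spherical cap $\{y:\|y\|=R,\ \langle y-w_{t,k},w_{t,k}\rangle\ge-\beta_tR\}$, and such that, if $\beta_t<(1-\frac{\sqrt2}{2})R$, $$K_t\ \ge\ \frac{((d-1)^2-1)\sqrt\pi}{d-1}\,\frac{\Gamma(\frac{d-1}2+1)}{\Gamma(\frac{d-1}2+\frac32)}\Bigl(\frac{R}{2\beta_t}\Bigr)^{(d-2)/2};$$ values $v_{t,k}\in\bigl(\frac{\varepsilon}{2(T-1)},\frac{\varepsilon}{T-1}\bigr)$, and the functions $F_t(x)=\max_{k}\{0,\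 v_{t,k}+\frac{L_{t+1}}{R}\langle w_{t,k},x-w_{t,k}\rangle\}$. *Problem.* A stagewise independent multistage problem with stages $0,\dots,T$ and state space $\mathcal X$ in every stage: the root cost is $0$; stage $t\in\{1,\dots,T-1\}$ has $K_t$ equally likely nodes and stage $T$ has one node, with nodal costs, as functions of the parent state $z$ and the state $x$, $f_{1,k}(z,x)=L_1\|x-w_{1,k}\|$, $f_{t,k}(z,x)=F_{t-1}(z)+L_t\|x-w_{t,k}\|$ for $2\le t\le T-1$, and $f_{T,1}(z,x)=F_{T-1}(z)$. This problem is convex (each cost is jointly convex), and the costs of stage $t$ are $L_t$-Lipschitz in the parent state. *Algorithm.* Let $p_{t,k}$ be the node probabilities of stage $t$ (so $1/K_t$, and $1$ for $t=T$). The deterministic sampling dual dynamic programming algorithm with penalties $\psi=\|\cdot\|$, $\sigma_{t,k}=L_t$ and linear cuts ($\|\lambda\|\le L_t$, $\rho=0$) starts from $\underline{\mathcal Q}^0_t\equiv0$ for all $t$, $\overline{\mathcal Q}^0_t\equiv+\infty$ for $t<T$, $\underline{\mathcal Q}^i_T\equiv\overline{\mathcal Q}^i_T\equiv0$ for all $i$,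 any $x^1_0\in\mathcal X$ and $\mathrm{UB}_0=+\infty$. Iteration $i\ge1$ consists of the following steps. 1. Forward: for $t=1,\dots,T$ and every node $k$ of stage $t$ take any minimizer $(x^i_{t,k},z^i_{t,k})$ over $x,z\in\mathcal X$ of $f_{t,k}(z,x)+L_t\|x^i_{t-1}-z\|+\underline{\mathcal Q}^{i-1}_t(x)$; if $t<T$, let $x^i_t=x^i_{t,k^*}$ for any $k^*$ maximizing $\overline{\mathcal Q}^{i-1}_t(x^i_{t,k})-\underline{\mathcal Q}^{i-1}_t(x^i_{t,k})$ over $k$. 2. Backward: for $t=T,\dots,1$ and every node $k$ of stage $t$ take any $\hat\lambda^i_{t,k}$ attaining $$\underline v^i_{t,k}=\max_{\|\lambda\|\le L_t}\ \min_{x,z\in\mathcal X}\{f_{t,k}(z,x)+\langle\lambda,x^i_{t-1}-z\rangle+\underline{\mathcal Q}^i_t(x)\},$$ let $\overline v^i_{t,k}=f_{t,k}(z^i_{t,k},x^i_{t,k})+L_t\|x^i_{t-1}-z^i_{t,k}\|+\overline{\mathcal Q}^i_t(x^i_{t,k})$, and then $$\underline{\mathcal Q}^i_{t-1}(x)=\max\Bigl\{\underline{\mathcal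 Q}^{i-1}_{t-1}(x),\ \sum_kp_{t,k}\bigl(\underline v^i_{t,k}-\langle\hat\lambda^i_{t,k},x^i_{t-1}-x\rangle\bigr)\Bigr\},$$ $$\overline{\mathcal Q}^i_{t-1}=\Bigl(\min\Bigl\{\overline{\mathcal Q}^{i-1}_{t-1},\ \sum_kp_{t,k}\bigl(\overline v^i_{t,k}+L_t\|\cdot-x^i_{t-1}\|\bigr)\Bigr\}\Bigr)^{**},$$ where $g^{**}(x)=\sup_{\lambda\in\mathbb R^d}\inf_{z\in\mathbb R^d}\{g(z)+\langle\lambda,x-z\rangle\}$. 3. Root: take any minimizer $x^{i+1}_0$ of $\underline{\mathcal Q}^i_0$ on $\mathcal X$ and set $\mathrm{LB}_i=\underline{\mathcal Q}^i_0(x^{i+1}_0)$, $\mathrm{UB}_i=\min\{\mathrm{UB}_{i-1},\overline{\mathcal Q}^i_0(x^{i+1}_0)\}$. *Conclusion.* For this problem, whichever optimal solutions the subproblem oracles return and however ties are broken: if $\mathrm{UB}_i-\mathrm{LB}_i<\varepsilon$ at the end of the $i$-th iteration, then $$i>\frac13\,\frac{d(d-2)\sqrt\pi}{d-1}\,\frac{\Gamma(\frac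 d2+\frac12)}{\Gamma(\frac d2+1)}\Bigl(\frac{DL(T-1)}{8\varepsilon}\Bigr)^{(d-2)/2}.$$ -/

import Mathlib

noncomputable section

/-- A stagewise independent multistage stochastic program with stages `0, …, T` (stage `0` is the
root), given by its recombining scenario tree.  All states lie in `ℝ^d`, and the nodal problems have
no decision variables besides the state.  Stage `t` (for `1 ≤ t ≤ T`) has `N t` distinct nodes, node
`(t, k)` has conditional probability `p t k` and nodal cost `f t k z x`, where `z` is the
parent state and `x` the state of the node; `X t` is the state space of stage `t` and `f0` the
root cost.  (Entries at stages outside the stated ranges are never used.) -/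
structure StagewiseProblem (d : ℕ) where
  T : ℕ
  N : ℕ → ℕ
  p : (t : ℕ) → Fin (N t) → ℝ
  X : ℕ → Set (EuclideanSpace ℝ (Fin d))
  f0 : EuclideanSpace ℝ (Fin d) → ℝ
  f : (t : ℕ) → Fin (N t) → EuclideanSpace ℝ (Fin d) → EuclideanSpace ℝ (Fin d) → ℝ

namespace StagewiseProblem

variable {d : ℕ}

/-- The problem is convex: the state spaces are convex, and every nodal cost is convex, jointly in
the parent state and the state of the node. -/
def IsConvex (P : StagewiseProblem d) : Prop :=
  (∀ t, t ≤ P.T → Convex ℝ (P.X t)) ∧ ConvexOn ℝ (P.X 0) P.f0 ∧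
    ∀ t, 1 ≤ t → t ≤ P.T → ∀ k : Fin (P.N t),
      ConvexOn ℝ (P.X (t - 1) ×ˢ P.X t) (fun q => P.f t k q.1 q.2)

/-- The nodal costs of stage `t` are `l t`-Lipschitz in the parent state. -/
def HasLipschitzCosts (P : StagewiseProblem d) (l : ℕ → ℝ) : Prop :=
  ∀ t, 1 ≤ t → t ≤ P.T → ∀ k : Fin (P.N t),
    ∀ z ∈ P.X (t - 1), ∀ z' ∈ P.X (t - 1), ∀ x ∈ P.X t,
      |P.f t k z x - P.f t k z' x| ≤ l t * ‖z - z'‖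

/-- The regularization and cut parameters of the nodes: penalty function `ψ`, penalty factor `σ`,
and the bounds `lLam`, `lRho` on the dual variables. -/
structure Regularization (P : StagewiseProblem d) where
  ψ : (t : ℕ) → Fin (P.N t) → EuclideanSpace ℝ (Fin d) → ℝ
  σ : (t : ℕ) → Fin (P.N t) → ℝ
  lLam : (t : ℕ) → Fin (P.N t) → ℝ
  lRho : (t : ℕ) → Fin (P.N t) → ℝ

variable {P : StagewiseProblem d}

/-- Objective of the forward step subproblem of node `(t, k)` with parent state `a` and
under-approximation `Θ` of the expected cost-to-go. -/
def forwardObj (A : Regularization P) (t : ℕ) (k : Fin (P.N t)) (a : EuclideanSpace ℝ (Fin d))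
    (Θ : EuclideanSpace ℝ (Fin d) → ℝ) (x z : EuclideanSpace ℝ (Fin d)) : ℝ :=
  P.f t k z x + A.σ t k * A.ψ t k (a - z) + Θ x

/-- `(x, z)` is an optimal solution of the forward step subproblem. -/
def IsForwardSolution (A : Regularization P) (t : ℕ) (k : Fin (P.N t))
    (a : EuclideanSpace ℝ (Fin d)) (Θ : EuclideanSpace ℝ (Fin d) → ℝ)
    (x z : EuclideanSpace ℝ (Fin d)) : Prop :=
  x ∈ P.X t ∧ z ∈ P.X (t - 1) ∧
    ∀ x' ∈ P.X t, ∀ z' ∈ P.X (t - 1), forwardObj A t k a Θ x z ≤ forwardObj A t k a Θ x' z'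

/-- Objective of the (max-min) backward step subproblem of node `(t, k)`. -/
def backwardObj (A : Regularization P) (t : ℕ) (k : Fin (P.N t)) (a : EuclideanSpace ℝ (Fin d))
    (Θ : EuclideanSpace ℝ (Fin d) → ℝ) (lam : EuclideanSpace ℝ (Fin d)) (rho : ℝ)
    (x z : EuclideanSpace ℝ (Fin d)) : ℝ :=
  P.f t k z x + inner ℝ lam (a - z) + rho * A.ψ t k (a - z) + Θ x

/-- The compact set of admissible dual variables of node `(t, k)`. -/
def dualSet (A : Regularization P) (t : ℕ) (k : Fin (P.N t)) :
    Set (EuclideanSpace ℝ (Fin d) × ℝ) :=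
  {u | ‖u.1‖ ≤ A.lLam t k ∧ 0 ≤ u.2 ∧ u.2 ≤ A.lRho t k}

/-- `(x, z; lam, rho)` is an optimal solution of the backward step subproblem
`max_{(λ, ρ)} min_{x, z}`: the pair `(x, z)` attains the inner minimum at `(lam, rho)`, and for every
other admissible `(λ, ρ)` the inner minimum is not larger. -/
def IsBackwardSolution (A : Regularization P) (t : ℕ) (k : Fin (P.N t))
    (a : EuclideanSpace ℝ (Fin d)) (Θ : EuclideanSpace ℝ (Fin d) → ℝ)
    (x z lam : EuclideanSpace ℝ (Fin d)) (rho : ℝ) : Prop :=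
  (lam, rho) ∈ dualSet A t k ∧ x ∈ P.X t ∧ z ∈ P.X (t - 1) ∧
    (∀ x' ∈ P.X t, ∀ z' ∈ P.X (t - 1),
      backwardObj A t k a Θ lam rho x z ≤ backwardObj A t k a Θ lam rho x' z') ∧
    ∀ u ∈ dualSet A t k, ∃ x' ∈ P.X t, ∃ z' ∈ P.X (t - 1),
      backwardObj A t k a Θ u.1 u.2 x' z' ≤ backwardObj A t k a Θ lam rho x z

/-- Convex hull operation on functions on `ℝ^d`: the convex biconjugate of `min {f, g}`. -/
def convMin (f g : EuclideanSpace ℝ (Fin d) → EReal) (x : EuclideanSpace ℝ (Fin d)) : EReal :=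
  ⨆ lam : EuclideanSpace ℝ (Fin d), ⨅ z : EuclideanSpace ℝ (Fin d),
    (min (f z) (g z) + ((inner ℝ lam (x - z) : ℝ) : EReal))

/-- The quantities produced by the deterministic sampling dual dynamic programming algorithm.  The
first argument is the iteration, the second one the stage.  `xF, zF` are the forward step solutions
of the nodes, `x i t` is the state of stage `t`, `xB, zB, lam, rho` are the backward step
solutions, `underQ`, `overQ` are the under- and over-approximations of the expected cost-to-go
functions, and `lower i`, `upper i` are the bounds at the end of iteration `i`. -/
structure Run (P : StagewiseProblem d) where
  xF : ℕ → (t : ℕ) → Fin (P.N t) → EuclideanSpace ℝ (Fin d)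
  zF : ℕ → (t : ℕ) → Fin (P.N t) → EuclideanSpace ℝ (Fin d)
  x : ℕ → ℕ → EuclideanSpace ℝ (Fin d)
  xB : ℕ → (t : ℕ) → Fin (P.N t) → EuclideanSpace ℝ (Fin d)
  zB : ℕ → (t : ℕ) → Fin (P.N t) → EuclideanSpace ℝ (Fin d)
  lam : ℕ → (t : ℕ) → Fin (P.N t) → EuclideanSpace ℝ (Fin d)
  rho : ℕ → (t : ℕ) → Fin (P.N t) → ℝ
  underQ : ℕ → ℕ → EuclideanSpace ℝ (Fin d) → ℝ
  overQ : ℕ → ℕ → EuclideanSpace ℝ (Fin d) → EReal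
  lower : ℕ → ℝ
  upper : ℕ → EReal

namespace Run

/-- The optimal value of the backward step subproblem of node `(t, k)` in iteration `i`. -/
def vLow (r : Run P) (A : Regularization P) (i t : ℕ) (k : Fin (P.N t)) : ℝ :=
  backwardObj A t k (r.x i (t - 1)) (r.underQ i t) (r.lam i t k) (r.rho i t k)
    (r.xB i t k) (r.zB i t k)

/-- The generalized conjugacy cut of node `(t, k)` generated in iteration `i`. -/
def cut (r : Run P) (A : Regularization P) (i t : ℕ) (k : Fin (P.N t))
    (y : EuclideanSpace ℝ (Fin d)) : ℝ :=
  -inner ℝ (r.lam i t k) (r.x i (t - 1) - y) - r.rho i t k * A.ψ t k (r.x i (t - 1) - y)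
    + r.vLow A i t k

/-- The upper bound on the regularized value function of node `(t, k)` at the parent state. -/
def vUp (r : Run P) (A : Regularization P) (i t : ℕ) (k : Fin (P.N t)) : EReal :=
  ((P.f t k (r.zF i t k) (r.xF i t k)
      + A.σ t k * A.ψ t k (r.x i (t - 1) - r.zF i t k) : ℝ) : EReal)
    + r.overQ i t (r.xF i t k)

/-- The over-approximation of the stage-`t` expected cost-to-go generated in iteration `i`. -/
def overNew (r : Run P) (A : Regularization P) (i t : ℕ) (y : EuclideanSpace ℝ (Fin d)) : EReal :=
  ∑ m : Fin (P.N (t + 1)), ((P.p (t + 1) m : ℝ) : EReal) *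
    (r.vUp A i (t + 1) m + ((A.σ (t + 1) m * ‖y - r.x i t‖ : ℝ) : EReal))

/-- The approximation gap of node `(t, k)` computed in the forward step of iteration `i + 1`. -/
def gap (r : Run P) (i t : ℕ) (k : Fin (P.N t)) : EReal :=
  r.overQ i t (r.xF (i + 1) t k) - ((r.underQ i t (r.xF (i + 1) t k) : ℝ) : EReal)

/-- `r` records the first `n` iterations of the deterministic sampling dual dynamic programming
algorithm on `P` with parameters `A`.  Iterations are numbered `1, …, n`.  The subproblem oracles
may return any optimal solution, and ties in the choice of the sampled node are broken arbitrarily;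
what the record contains beyond iteration `n` is irrelevant. -/
structure IsRun (A : Regularization P) (n : ℕ) (r : Run P) : Prop where
  /-- initialization -/
  under_zero : ∀ t, t ≤ P.T → ∀ y, r.underQ 0 t y = 0
  over_zero : ∀ t, t < P.T → ∀ y, r.overQ 0 t y = ⊤
  upper_zero : r.upper 0 = ⊤
  /-- root node step: `x_0^{i+1}` solves the root problem with the `i`-th under-approximation -/
  root_mem : ∀ i, i ≤ n → r.x (i + 1) 0 ∈ P.X 0
  root_opt : ∀ i, i ≤ n → ∀ y ∈ P.X 0,
    P.f0 (r.x (i + 1) 0) + r.underQ i 0 (r.x (i + 1) 0) ≤ P.f0 y + r.underQ i 0 y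
  /-- forward step of iteration `i + 1` -/
  forward : ∀ i, i < n → ∀ t, 1 ≤ t → t ≤ P.T → ∀ k : Fin (P.N t),
    IsForwardSolution A t k (r.x (i + 1) (t - 1)) (r.underQ i t)
      (r.xF (i + 1) t k) (r.zF (i + 1) t k)
  select : ∀ i, i < n → ∀ t, 1 ≤ t → t < P.T →
    ∃ k : Fin (P.N t), (∀ k', r.gap i t k' ≤ r.gap i t k) ∧ r.x (i + 1) t = r.xF (i + 1) t k
  /-- backward step of iteration `i + 1` -/
  backward : ∀ i, i < n → ∀ t, 1 ≤ t → t ≤ P.T → ∀ k : Fin (P.N t),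
    IsBackwardSolution A t k (r.x (i + 1) (t - 1)) (r.underQ (i + 1) t)
      (r.xB (i + 1) t k) (r.zB (i + 1) t k) (r.lam (i + 1) t k) (r.rho (i + 1) t k)
  /-- update of the approximations in iteration `i + 1` -/
  under_last : ∀ i, i < n → ∀ y, r.underQ (i + 1) P.T y = 0
  under_step : ∀ i, i < n → ∀ t, t < P.T → ∀ y,
    r.underQ (i + 1) t y =
      max (r.underQ i t y) (∑ m : Fin (P.N (t + 1)), P.p (t + 1) m * r.cut A (i + 1) (t + 1) m y)
  over_last : ∀ i, i ≤ n → ∀ y, r.overQ i P.T y = 0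
  over_step_convex : P.IsConvex → ∀ i, i < n → ∀ t, t < P.T → ∀ y,
    r.overQ (i + 1) t y = convMin (r.overQ i t) (r.overNew A (i + 1) t) y
  over_step_nonconvex : ¬ P.IsConvex → ∀ i, i < n → ∀ t, t < P.T → ∀ y,
    r.overQ (i + 1) t y = min (r.overQ i t y) (r.overNew A (i + 1) t y)
  /-- update of the bounds -/
  lower_eq : ∀ i, i ≤ n → r.lower i = P.f0 (r.x (i + 1) 0) + r.underQ i 0 (r.x (i + 1) 0)
  upper_step : ∀ i, i < n → r.upper (i + 1) =
    min (r.upper i) (((P.f0 (r.x (i + 2) 0) : ℝ) : EReal) + r.overQ (i + 1) 0 (r.x (i + 2) 0))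

end Run

end StagewiseProblem

/-- The spherical cap of depth `β` centered at the point `x` of the sphere of radius `R`. -/
def sphericalCap {d : ℕ} (R β : ℝ) (x : EuclideanSpace ℝ (Fin d)) :
    Set (EuclideanSpace ℝ (Fin d)) :=
  {y | ‖y‖ = R ∧ -β * R ≤ inner ℝ (y - x) x}

/-- The cardinality guaranteed for cap packings on the `m`-sphere of radius `R`, depth `β`. -/
def capCount (m R β : ℝ) : ℝ :=
  (m ^ 2 - 1) * √Real.pi / m * (Real.Gamma (m / 2 + 1) / Real.Gamma (m / 2 + 3 / 2)) *
    (R / (2 * β)) ^ ((m - 1) / 2)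

/-- Distinct points `w 1, …, w K` of the `(d-1)`-sphere of radius `R` in `ℝ^d` such that the cap of
depth `β` around each of them contains no other one, and whose number is as large as guaranteed
for small depths. -/
structure IsCapPacking {d K : ℕ} (R β : ℝ) (w : Fin K → EuclideanSpace ℝ (Fin d)) : Prop where
  injective : Function.Injective w
  norm_eq : ∀ k, ‖w k‖ = R
  cap_inter : ∀ k, sphericalCap R β (w k) ∩ Set.range w = {w k}
  card_ge : β < (1 - √2 / 2) * R → capCount ((d : ℝ) - 1) R β ≤ K

/-- The data of the multistage convex example with `T` (number of stages), `L` (Lipschitz constant),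
`D` (state space diameter) and `ε` (optimality gap): constants `L / 2 ≤ L_T < ⋯ < L_1 ≤ L`, and
for each stage `1 ≤ t ≤ T - 1` a nonempty packing `w t` with caps of depth `ε / ((T-1) L_{t+1})`
and values `v t`.  The last stage has a single node; its `w`, `v` are not used. -/
structure SphericalCapExample (d T : ℕ) (L D ε : ℝ) where
  lip : ℕ → ℝ
  lip_one_le : lip 1 ≤ L
  le_lip_last : L / 2 ≤ lip T
  lip_lt : ∀ t, 1 ≤ t → t < T → lip (t + 1) < lip t
  K : ℕ → ℕ
  K_pos : ∀ t, 1 ≤ t → t < T → 0 < K t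
  K_last : K T = 1
  w : (t : ℕ) → Fin (K t) → EuclideanSpace ℝ (Fin d)
  packing : ∀ t, 1 ≤ t → t < T →
    IsCapPacking (D / 2) (ε / (((T : ℝ) - 1) * lip (t + 1))) (w t)
  v : (t : ℕ) → Fin (K t) → ℝ
  v_mem : ∀ t, 1 ≤ t → t < T → ∀ k,
    v t k ∈ Set.Ioo (ε / (2 * (T : ℝ) - 2)) (ε / ((T : ℝ) - 1))

namespace SphericalCapExample

variable {d T : ℕ} {L D ε : ℝ}

/-- The piecewise linear function
`F_t(x) = max_k {0, v_{t,k} + (L_{t+1} / R) ⟨w_{t,k}, x - w_{t,k}⟩}` with `R = D / 2`. -/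
def F (S : SphericalCapExample d T L D ε) (t : ℕ) (x : EuclideanSpace ℝ (Fin d)) : ℝ :=
  max 0 (⨆ k : Fin (S.K t),
    (S.v t k + S.lip (t + 1) / (D / 2) * inner ℝ (S.w t k) (x - S.w t k)))

/-- The problem: root cost `0`, `f_{1,k}(z, x) = L_1 ‖x - w_{1,k}‖`,
`f_{t,k}(z, x) = F_{t-1}(z) + L_t ‖x - w_{t,k}‖` for `2 ≤ t ≤ T - 1`, `f_{T,1}(z, x) = F_{T-1}(z)`,
uniform conditional probabilities, and the ball of diameter `D` as state space. -/
def problem (S : SphericalCapExample d T L D ε) : StagewiseProblem d where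
  T := T
  N := S.K
  p := fun t _ => 1 / (S.K t : ℝ)
  X := fun _ => Metric.closedBall 0 (D / 2)
  f0 := fun _ => 0
  f := fun t k z x =>
    (if t = 1 then 0 else S.F (t - 1) z) + (if t = T then 0 else S.lip t * ‖x - S.w t k‖)

/-- Norm penalties with factors `σ = L_t`, and linear cuts: `‖λ‖ ≤ L_t` and `ρ = 0`. -/
def regularization (S : SphericalCapExample d T L D ε) : S.problem.Regularization where
  ψ := fun _ _ y => ‖y‖
  σ := fun t _ => S.lip t
  lLam := fun t _ => S.lip t
  lRho := fun _ _ => 0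

end SphericalCapExample

end

/-! ### The piecewise linear functions F_t and convexity of the problem. -/

namespace SphericalCapExample

open Finset

variable {d T : ℕ} {L D ε : ℝ} (S : SphericalCapExample d T L D ε)

/-! Write e = ε/(T-1). Every under-approximation of stage t is L_{t+1}-Lipschitz and L_{t+1} < L_t,
so the cost L_t‖x - w_{t,k}‖ forces node (t,k) to choose the state w_{t,k} (`xF_eq`). An iteration
therefore samples one packing point per stage, and after n iterations at most n nodes of each stage
have been visited.

The packing makes a visit uninformative about the other points: piece k of F_t drops by more than e
from w_{t,k} to any other packing point, while e/2 < v_{t,k} < e. From below, a cut generated at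
w_{t,k}, whatever optimal multiplier is returned, contributes nothing at the other points
(`cut_le_of_ne`), so an unvisited node is still credited with at most 0. From above, the affine
function with the slope of piece k and value 3e/2 at w_{t,k} is below e/2 at any sampled w_{t,k'},
hence below the cone generated there. Being affine, it survives the biconjugate (`overBound_succ`).

These errors add up over the stages: the gap at the root is at least the sum over the stages of 3e/2
times the fraction of unvisited nodes. A gap below ε = (T-1)e thus requires K_t < 3n in some stage
(`exists_card_lt_of_gap_lt`).

Large packings are found greedily: a new point exists as long as the circular cones around the old
ones cannot cover the unit ball, by volume (`exists_inner_lt`, `sector_mul_lt`). For cap depths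
beyond the volume estimate an orthonormal basis or a single point is enough
(`exists_capPacking_bound`). -/

theorem half_le_lip {t : ℕ} (ht : 1 ≤ t) (htT : t ≤ T) : L / 2 ≤ S.lip t := by
  induction htT using Nat.decreasingInduction with
  | self => exact S.le_lip_last
  | of_succ k hk ih => exact (ih (by omega)).trans (S.lip_lt k ht hk).le

theorem lip_pos (hL : 0 < L) {t : ℕ} (ht : 1 ≤ t) (htT : t ≤ T) : 0 < S.lip t :=
  lt_of_lt_of_le (by positivity) (S.half_le_lip ht htT)

/-- The affine pieces of `F`. -/
noncomputable def piece (t : ℕ) (k : Fin (S.K t)) (x : EuclideanSpace ℝ (Fin d)) : ℝ :=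
  S.v t k + S.lip (t + 1) / (D / 2) * inner ℝ (S.w t k) (x - S.w t k)

theorem F_nonneg (t : ℕ) (x : EuclideanSpace ℝ (Fin d)) : 0 ≤ S.F t x := le_max_left _ _

theorem piece_le_F (t : ℕ) (k : Fin (S.K t)) (x : EuclideanSpace ℝ (Fin d)) :
    S.piece t k x ≤ S.F t x :=
  le_max_of_le_right (le_ciSup (f := fun k => S.piece t k x) (Set.finite_range _).bddAbove k)

theorem F_le {t : ℕ} (h1 : 1 ≤ t) (hT : t < T) {x : EuclideanSpace ℝ (Fin d)} {c : ℝ}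
    (hc : 0 ≤ c) (h : ∀ k, S.piece t k x ≤ c) : S.F t x ≤ c := by
  have : Nonempty (Fin (S.K t)) := ⟨⟨0, S.K_pos t h1 hT⟩⟩
  exact max_le hc (ciSup_le h)

theorem norm_w {t : ℕ} (h1 : 1 ≤ t) (hT : t < T) (k : Fin (S.K t)) : ‖S.w t k‖ = D / 2 :=
  (S.packing t h1 hT).norm_eq k

theorem w_mem {t : ℕ} (h1 : 1 ≤ t) (hT : t < T) (k : Fin (S.K t)) :
    S.w t k ∈ Metric.closedBall (0 : EuclideanSpace ℝ (Fin d)) (D / 2) := by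
  rw [mem_closedBall_zero_iff, S.norm_w h1 hT k]

theorem v_pos (hT2 : 2 ≤ T) (hε : 0 < ε) {t : ℕ} (h1 : 1 ≤ t) (hT : t < T) (k : Fin (S.K t)) :
    0 < S.v t k := by
  have h := (S.v_mem t h1 hT k).1
  have : (2 : ℝ) ≤ T := by exact_mod_cast hT2
  refine lt_of_le_of_lt ?_ h
  apply div_nonneg hε.le
  linarith

theorem v_lt {t : ℕ} (h1 : 1 ≤ t) (hT : t < T) (k : Fin (S.K t)) :
    S.v t k < ε / ((T : ℝ) - 1) := (S.v_mem t h1 hT k).2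

theorem lt_v {t : ℕ} (h1 : 1 ≤ t) (hT : t < T) (k : Fin (S.K t)) :
    ε / ((T : ℝ) - 1) / 2 < S.v t k := by
  have h : ε / ((T : ℝ) - 1) / 2 = ε / (2 * (T : ℝ) - 2) := by
    rw [div_div]
    congr 1
    ring
  rw [h]
  exact (S.v_mem t h1 hT k).1

theorem F_convex {t : ℕ} (h1 : 1 ≤ t) (hT : t < T) : ConvexOn ℝ Set.univ (S.F t) := by
  refine ⟨convex_univ, fun x _ y _ a b ha hb hab => ?_⟩
  simp only [smul_eq_mul]
  have hx := S.F_nonneg t x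
  have hy := S.F_nonneg t y
  refine S.F_le h1 hT (by positivity) fun k => ?_
  have h2 : S.piece t k (a • x + b • y) = a * S.piece t k x + b * S.piece t k y := by
    have hw : S.w t k = a • S.w t k + b • S.w t k := by rw [← add_smul, hab, one_smul]
    have hb' : b = 1 - a := by linarith
    simp only [piece, inner_sub_right, inner_add_right, inner_smul_right]
    rw [hb']
    ring
  rw [h2]
  have h3 := S.piece_le_F t k x
  have h4 := S.piece_le_F t k y
  gcongr

theorem problem_isConvex (hL : 0 < L) : S.problem.IsConvex := by
  refine ⟨fun t _ => convex_closedBall _ _, convexOn_const _ (convex_closedBall _ _), ?_⟩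
  intro t h1 hT k
  change t ≤ T at hT
  have hX : Convex ℝ (Metric.closedBall (0 : EuclideanSpace ℝ (Fin d)) (D / 2)
      ×ˢ Metric.closedBall (0 : EuclideanSpace ℝ (Fin d)) (D / 2)) :=
    (convex_closedBall _ _).prod (convex_closedBall _ _)
  refine ConvexOn.add (f := fun q : EuclideanSpace ℝ (Fin d) × EuclideanSpace ℝ (Fin d) =>
    (if t = 1 then 0 else S.F (t - 1) q.1))
    (g := fun q => if t = T then 0 else S.lip t * ‖q.2 - S.w t k‖) ?_ ?_
  · by_cases h : t = 1
    · simp only [h, if_true]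
      exact convexOn_const _ hX
    · simp only [h, if_false]
      have := (S.F_convex (t := t - 1) (by omega) (by omega)).comp_linearMap
        (LinearMap.fst ℝ (EuclideanSpace ℝ (Fin d)) (EuclideanSpace ℝ (Fin d)))
      exact this.subset (by simp) hX
  · by_cases h : t = T
    · simp only [h, if_true]
      exact convexOn_const _ hX
    · simp only [h, if_false]
      have h2 : ConvexOn ℝ Set.univ (fun x : EuclideanSpace ℝ (Fin d) => ‖x - S.w t k‖) := by
        simpa [dist_eq_norm] using (convexOn_dist (S.w t k) convex_univ)
      have := (h2.smul (S.lip_pos hL h1 hT).le).comp_linearMap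
        (LinearMap.snd ℝ (EuclideanSpace ℝ (Fin d)) (EuclideanSpace ℝ (Fin d)))
      exact this.subset (by simp) hX

section Pieces

variable (hD : 0 < D) (hL : 0 < L)
include hD hL

theorem slope_inner_le {t : ℕ} (h1 : 1 ≤ t) (hT : t < T) (k : Fin (S.K t))
    (u : EuclideanSpace ℝ (Fin d)) :
    S.lip (t + 1) / (D / 2) * inner ℝ (S.w t k) u ≤ S.lip (t + 1) * ‖u‖ := by
  have hl := S.lip_pos hL (t := t + 1) (by omega) hT
  have h := real_inner_le_norm (S.w t k) u
  rw [S.norm_w h1 hT k] at h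
  calc S.lip (t + 1) / (D / 2) * inner ℝ (S.w t k) u
      ≤ S.lip (t + 1) / (D / 2) * (D / 2 * ‖u‖) := by gcongr
    _ = S.lip (t + 1) * ‖u‖ := by field_simp

/-- Leaving the cap of depth β_t costs piece k more than (L_{t+1}/R)·β_t R, and β_t is chosen to
make this ε/(T-1). -/
theorem slope_inner_lt (hT2 : 2 ≤ T) {t : ℕ} (h1 : 1 ≤ t) (hT : t < T) {j k : Fin (S.K t)}
    (hjk : j ≠ k) :
    S.lip (t + 1) / (D / 2) * inner ℝ (S.w t k) (S.w t j - S.w t k) < -(ε / ((T : ℝ) - 1)) := by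
  have hl := S.lip_pos hL (t := t + 1) (by omega) hT
  have hTr : (0 : ℝ) < (T : ℝ) - 1 := by
    have : (2 : ℝ) ≤ T := by exact_mod_cast hT2
    linarith
  have hP := S.packing t h1 hT
  have hn : S.w t j ∉ sphericalCap (D / 2) (ε / (((T : ℝ) - 1) * S.lip (t + 1))) (S.w t k) := by
    intro hc
    have : S.w t j ∈ ({S.w t k} : Set (EuclideanSpace ℝ (Fin d))) := by
      rw [← hP.cap_inter k]
      exact ⟨hc, Set.mem_range_self j⟩
    exact hjk (hP.injective this)
  have hn' : inner ℝ (S.w t j - S.w t k) (S.w t k)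
      < -(ε / (((T : ℝ) - 1) * S.lip (t + 1))) * (D / 2) := by
    by_contra hcon
    exact hn ⟨hP.norm_eq j, not_lt.1 hcon⟩
  rw [real_inner_comm]
  calc S.lip (t + 1) / (D / 2) * inner ℝ (S.w t j - S.w t k) (S.w t k)
      < S.lip (t + 1) / (D / 2) * (-(ε / (((T : ℝ) - 1) * S.lip (t + 1))) * (D / 2)) := by gcongr
    _ = -(ε / ((T : ℝ) - 1)) := by field_simp

theorem F_sub_le {t : ℕ} (h1 : 1 ≤ t) (hT : t < T) (z z' : EuclideanSpace ℝ (Fin d)) :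
    S.F t z ≤ S.F t z' + S.lip (t + 1) * ‖z - z'‖ := by
  have hl := S.lip_pos hL (t := t + 1) (by omega) hT
  apply S.F_le h1 hT
  · have := S.F_nonneg t z'
    positivity
  · intro k
    have h2 := S.piece_le_F t k z'
    have h3 := S.slope_inner_le hD hL h1 hT k (z - z')
    have h4 : S.piece t k z = S.piece t k z'
        + S.lip (t + 1) / (D / 2) * inner ℝ (S.w t k) (z - z') := by
      simp only [piece, inner_sub_right]
      ring
    linarith

/-- All other pieces are negative at w_{t,k}, since they have dropped by more than ε/(T-1), which
exceeds their peak values. -/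
theorem F_w (hT2 : 2 ≤ T) (hε : 0 < ε) {t : ℕ} (h1 : 1 ≤ t) (hT : t < T) (k : Fin (S.K t)) :
    S.F t (S.w t k) = S.v t k := by
  apply le_antisymm
  · refine S.F_le h1 hT (S.v_pos hT2 hε h1 hT k).le fun j => ?_
    by_cases hjk : k = j
    · subst hjk
      simp [piece]
    · have h3 := S.slope_inner_lt hD hL hT2 h1 hT hjk
      have h4 := S.v_lt h1 hT j
      have h5 := S.v_pos hT2 hε h1 hT k
      simp only [piece]
      linarith
  · simpa [piece] using S.piece_le_F t k (S.w t k)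

/-- Near a packing point `F` coincides with the corresponding affine piece; towards another packing
point this gives a strict decrease with a fixed slope. -/
theorem exists_F_segment_le (hT2 : 2 ≤ T) (hε : 0 < ε) {t : ℕ} (h1 : 1 ≤ t) (hT : t < T)
    {j k : Fin (S.K t)} (hjk : j ≠ k) :
    ∃ s : ℝ, 0 < s ∧ s ≤ 1 ∧
      S.F t (S.w t k + s • (S.w t j - S.w t k)) ≤ S.v t k - s * (ε / ((T : ℝ) - 1)) := by
  have hl := S.lip_pos hL (t := t + 1) (by omega) hT
  have hTr : (0 : ℝ) < (T : ℝ) - 1 := by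
    have : (2 : ℝ) ≤ T := by exact_mod_cast hT2
    linarith
  set e := ε / ((T : ℝ) - 1) with he
  have he0 : 0 < e := by positivity
  have hv := S.v_pos hT2 hε h1 hT k
  set l := S.lip (t + 1) with hl'
  have hnj := S.norm_w h1 hT j
  have hnk := S.norm_w h1 hT k
  have hdist : ‖S.w t j - S.w t k‖ ≤ D := by
    have := norm_sub_le (S.w t j) (S.w t k)
    rw [hnj, hnk] at this
    linarith
  have hδ : 0 < min (S.v t k / e) ((S.v t k) / (l * D + e)) := by
    have : 0 < l * D + e := by positivity
    positivity
  -- The bound v/e keeps the target value nonnegative, as the maximum with 0 requires. The bound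
  -- v/(lD + e) prevents the other pieces, negative at w_{t,k} and growing by at most s·l·D, from
  -- overtaking the target.
  refine ⟨min 1 (min (S.v t k / e) (S.v t k / (l * D + e))), lt_min one_pos hδ, min_le_left _ _, ?_⟩
  set s := min 1 (min (S.v t k / e) (S.v t k / (l * D + e))) with hs
  have hs0 : 0 < s := lt_min one_pos hδ
  have hs1 : s ≤ 1 := min_le_left _ _
  have hs2 : s * e ≤ S.v t k := by
    have : s ≤ S.v t k / e := (min_le_right _ _).trans (min_le_left _ _)
    rwa [le_div_iff₀ he0] at this
  have hs3 : s * (l * D + e) ≤ S.v t k := by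
    have : s ≤ S.v t k / (l * D + e) := (min_le_right _ _).trans (min_le_right _ _)
    rwa [le_div_iff₀ (by positivity)] at this
  refine S.F_le h1 hT (by linarith) fun m => ?_
  have hexp : S.piece t m (S.w t k + s • (S.w t j - S.w t k)) = S.v t m
      + l / (D / 2) * inner ℝ (S.w t m) (S.w t k - S.w t m)
      + s * (l / (D / 2) * inner ℝ (S.w t m) (S.w t j - S.w t k)) := by
    simp only [piece, inner_sub_right, inner_add_right, inner_smul_right, ← hl']
    ring
  rw [hexp]
  by_cases hmk : k = m
  · subst hmk
    have h3 := S.slope_inner_lt hD hL hT2 h1 hT hjk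
    rw [sub_self, inner_zero_right]
    rw [← hl', ← he] at h3
    nlinarith
  · have h3 := S.slope_inner_lt hD hL hT2 h1 hT hmk
    rw [← hl', ← he] at h3
    have h4 := S.v_lt h1 hT m
    rw [← he] at h4
    have h5 : s * (l / (D / 2) * inner ℝ (S.w t m) (S.w t j - S.w t k)) ≤ s * (l * D) := by
      have := S.slope_inner_le hD hL h1 hT m (S.w t j - S.w t k)
      rw [← hl'] at this
      exact mul_le_mul_of_nonneg_left (this.trans (by gcongr)) hs0.le
    nlinarith

theorem problem_hasLipschitzCosts : S.problem.HasLipschitzCosts S.lip := by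
  intro t h1 hT k z _ z' _ x _
  change t ≤ T at hT
  have hl := S.lip_pos hL h1 hT
  change |((if t = 1 then 0 else S.F (t - 1) z) + (if t = T then 0 else S.lip t * ‖x - S.w t k‖))
    - ((if t = 1 then 0 else S.F (t - 1) z') + (if t = T then 0 else S.lip t * ‖x - S.w t k‖))|
    ≤ S.lip t * ‖z - z'‖
  rw [add_sub_add_right_eq_sub]
  by_cases h : t = 1
  · simp only [h, if_true, sub_self, abs_zero]
    rw [← h]
    positivity
  · simp only [h, if_false]
    obtain ⟨s, rfl⟩ : ∃ s, t = s + 1 := ⟨t - 1, by omega⟩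
    have h2 := S.F_sub_le hD hL (t := s) (by omega) (by omega) z z'
    have h3 := S.F_sub_le hD hL (t := s) (by omega) (by omega) z' z
    rw [norm_sub_rev] at h3
    rw [abs_le, Nat.add_sub_cancel]
    constructor <;> linarith

end Pieces

end SphericalCapExample

/-! ### Forward states, and the values of the cuts at the packing points. -/

namespace SphericalCapExample

open Finset StagewiseProblem

theorem sum_one_div_mul_le {K : ℕ} (hK : 0 < K) {f g : Fin K → ℝ} {c : ℝ}
    (h : ∀ m, f m ≤ g m + c) : ∑ m, 1 / (K : ℝ) * f m ≤ ∑ m, 1 / (K : ℝ) * g m + c := by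
  have hK' : (0 : ℝ) < K := by exact_mod_cast hK
  calc ∑ m, 1 / (K : ℝ) * f m ≤ ∑ m, (1 / (K : ℝ) * g m + 1 / (K : ℝ) * c) := by
        refine sum_le_sum fun m _ => ?_
        rw [← mul_add]
        exact mul_le_mul_of_nonneg_left (h m) (by positivity)
    _ = ∑ m, 1 / (K : ℝ) * g m + c := by
        rw [sum_add_distrib, sum_const, card_univ, Fintype.card_fin, nsmul_eq_mul]
        field_simp

variable {d T : ℕ} {L D ε : ℝ} (S : SphericalCapExample d T L D ε)

theorem K_pos' {t : ℕ} (h1 : 1 ≤ t) (hT : t ≤ T) : 0 < S.K t := by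
  rcases hT.lt_or_eq with h | h
  · exact S.K_pos t h1 h
  · rw [h, S.K_last]
    exact one_pos

/-- The part of the nodal costs of stage `t + 1` that depends on the parent state. -/
noncomputable def parentCost (t : ℕ) (z : EuclideanSpace ℝ (Fin d)) : ℝ :=
  if t = 0 then 0 else S.F t z

/-- The part of the nodal costs that depends on the state of the node. -/
noncomputable def stateCost (t : ℕ) (k : Fin (S.K t)) (x : EuclideanSpace ℝ (Fin d)) : ℝ :=
  if t = T then 0 else S.lip t * ‖x - S.w t k‖

theorem problem_f (t : ℕ) (m : Fin (S.K (t + 1))) (z x : EuclideanSpace ℝ (Fin d)) :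
    S.problem.f (t + 1) m z x = S.parentCost t z + S.stateCost (t + 1) m x := by
  simp [problem, parentCost, stateCost]

theorem forwardObj_eq (t : ℕ) (m : Fin (S.K (t + 1))) (a : EuclideanSpace ℝ (Fin d))
    (Θ : EuclideanSpace ℝ (Fin d) → ℝ) (x z : EuclideanSpace ℝ (Fin d)) :
    forwardObj S.regularization (t + 1) m a Θ x z = S.parentCost t z + S.stateCost (t + 1) m x
      + S.lip (t + 1) * ‖a - z‖ + Θ x := by
  rw [← S.problem_f]
  rfl

theorem backwardObj_eq (t : ℕ) (m : Fin (S.K (t + 1))) (a : EuclideanSpace ℝ (Fin d))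
    (Θ : EuclideanSpace ℝ (Fin d) → ℝ) (lam x z : EuclideanSpace ℝ (Fin d)) :
    backwardObj S.regularization (t + 1) m a Θ lam 0 x z =
      S.parentCost t z + S.stateCost (t + 1) m x + inner ℝ lam (a - z) + Θ x := by
  rw [← S.problem_f]
  simp [backwardObj]

variable {S} {n : ℕ} {r : S.problem.Run}

section Lower

variable (hr : r.IsRun S.regularization n)
include hr

theorem rho_eq_zero {i t : ℕ} (hi : i < n) (h1 : 1 ≤ t) (hT : t ≤ T) (k : Fin (S.K t)) :
    r.rho (i + 1) t k = 0 :=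
  le_antisymm (hr.backward i hi t h1 hT k).1.2.2 (hr.backward i hi t h1 hT k).1.2.1

theorem norm_lam_le {i t : ℕ} (hi : i < n) (h1 : 1 ≤ t) (hT : t ≤ T) (k : Fin (S.K t)) :
    ‖r.lam (i + 1) t k‖ ≤ S.lip t :=
  (hr.backward i hi t h1 hT k).1.1

theorem cut_eq {i t : ℕ} (hi : i < n) (hT : t < T) (m : Fin (S.K (t + 1)))
    (y : EuclideanSpace ℝ (Fin d)) :
    r.cut S.regularization (i + 1) (t + 1) m y =
      r.vLow S.regularization (i + 1) (t + 1) m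
        - inner ℝ (r.lam (i + 1) (t + 1) m) (r.x (i + 1) t - y) := by
  have h := rho_eq_zero hr hi (t := t + 1) (by omega) hT m
  simp only [Run.cut, h, Nat.add_sub_cancel]
  ring

theorem underQ_step {i t : ℕ} (hi : i < n) (hT : t < T) (y : EuclideanSpace ℝ (Fin d)) :
    r.underQ (i + 1) t y = max (r.underQ i t y)
      (∑ m : Fin (S.K (t + 1)), 1 / (S.K (t + 1) : ℝ) *
        r.cut S.regularization (i + 1) (t + 1) m y) :=
  hr.under_step i hi t hT y

/-- The slope of an aggregated cut is an average of multipliers of norm at most L_{t+1}, and maxima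
preserve the Lipschitz constant. -/
theorem underQ_sub_le {i t : ℕ} (hL : 0 < L) (hi : i ≤ n) (hT : t < T)
    (y y' : EuclideanSpace ℝ (Fin d)) :
    r.underQ i t y ≤ r.underQ i t y' + S.lip (t + 1) * ‖y - y'‖ := by
  have hl := S.lip_pos hL (t := t + 1) (by omega) hT
  induction i with
  | zero =>
    rw [hr.under_zero t hT.le, hr.under_zero t hT.le]
    positivity
  | succ i ih =>
    rw [underQ_step hr hi hT, underQ_step hr hi hT, max_add]
    refine max_le_max (ih (by omega)) (sum_one_div_mul_le (S.K_pos' (by omega) hT) fun m => ?_)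
    rw [cut_eq hr hi hT, cut_eq hr hi hT]
    have h1 := real_inner_le_norm (r.lam (i + 1) (t + 1) m) (y - y')
    have h2 := norm_lam_le hr hi (t := t + 1) (by omega) hT m
    have h3 : ‖r.lam (i + 1) (t + 1) m‖ * ‖y - y'‖ ≤ S.lip (t + 1) * ‖y - y'‖ := by gcongr
    have h4 : inner ℝ (r.lam (i + 1) (t + 1) m) (y - y') =
      inner ℝ (r.lam (i + 1) (t + 1) m) (r.x (i + 1) t - y')
      - inner ℝ (r.lam (i + 1) (t + 1) m) (r.x (i + 1) t - y) := by
      rw [← inner_sub_right]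
      congr 1
      abel
    linarith

/-- Moving the state to w_{t,k}, with z fixed, saves L_t times the distance and raises the
under-approximation by at most L_{t+1} times it. As L_{t+1} < L_t, the oracle has no freedom in x.
-/
theorem xF_eq {i t : ℕ} (hL : 0 < L) (hi : i < n) (h1 : 1 ≤ t) (hT : t < T) (k : Fin (S.K t)) :
    r.xF (i + 1) t k = S.w t k := by
  obtain ⟨s, rfl⟩ : ∃ s, t = s + 1 := ⟨t - 1, by omega⟩
  obtain ⟨-, hz, h⟩ := hr.forward i hi (s + 1) h1 hT.le k
  have h2 := h (S.w (s + 1) k) (S.w_mem h1 hT k) _ hz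
  rw [S.forwardObj_eq, S.forwardObj_eq] at h2
  simp only [stateCost, hT.ne, if_false, sub_self, norm_zero, mul_zero] at h2
  have h3 := underQ_sub_le hr hL (i := i) hi.le hT (S.w (s + 1) k) (r.xF (i + 1) (s + 1) k)
  rw [norm_sub_rev] at h3
  have h4 := S.lip_lt (s + 1) h1 hT
  by_contra hne
  have h5 : 0 < ‖r.xF (i + 1) (s + 1) k - S.w (s + 1) k‖ := norm_pos_iff.2 (sub_ne_zero.2 hne)
  nlinarith

theorem exists_x_eq {i t : ℕ} (hL : 0 < L) (hi : i < n) (h1 : 1 ≤ t) (hT : t < T) :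
    ∃ k : Fin (S.K t), r.x (i + 1) t = S.w t k := by
  obtain ⟨k, -, hk⟩ := hr.select i hi t h1 hT
  exact ⟨k, hk.trans (xF_eq hr hL hi h1 hT k)⟩

omit hr in
/-- The minimum over the state of the node of the state cost plus under-approximation. -/
noncomputable def nodeValue (r : S.problem.Run) (i t : ℕ) (k : Fin (S.K t)) : ℝ :=
  if t = T then 0 else r.underQ i t (S.w t k)

theorem underQ_last {i : ℕ} (hi : i ≤ n) (y : EuclideanSpace ℝ (Fin d)) :
    r.underQ i T y = 0 := by
  cases i with
  | zero => exact hr.under_zero T le_rfl y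
  | succ i => exact hr.under_last i hi y

theorem nodeValue_le {i t : ℕ} (hL : 0 < L) (hi : i ≤ n) (h1 : 1 ≤ t) (hT : t ≤ T)
    (k : Fin (S.K t)) (x : EuclideanSpace ℝ (Fin d)) :
    nodeValue r i t k ≤ S.stateCost t k x + r.underQ i t x := by
  rcases hT.lt_or_eq with h | h
  · simp only [nodeValue, stateCost, h.ne, if_false]
    have h3 := underQ_sub_le hr hL hi h (S.w t k) x
    rw [norm_sub_rev] at h3
    have h4 := S.lip_lt t h1 h
    nlinarith [norm_nonneg (x - S.w t k)]
  · subst h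
    simp [nodeValue, stateCost, underQ_last hr hi]

theorem exists_eq_nodeValue {i t : ℕ} (hD : 0 < D) (hi : i ≤ n) (h1 : 1 ≤ t) (hT : t ≤ T)
    (k : Fin (S.K t)) :
    ∃ x ∈ Metric.closedBall (0 : EuclideanSpace ℝ (Fin d)) (D / 2),
      S.stateCost t k x + r.underQ i t x = nodeValue r i t k := by
  rcases hT.lt_or_eq with h | h
  · exact ⟨S.w t k, S.w_mem h1 h k, by simp [nodeValue, stateCost, h.ne]⟩
  · subst h
    exact ⟨0, by simpa using (half_pos hD).le, by simp [nodeValue, stateCost, underQ_last hr hi]⟩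

theorem vLow_le {i t : ℕ} (hD : 0 < D) (hi : i < n) (hT : t < T) (m : Fin (S.K (t + 1)))
    {z : EuclideanSpace ℝ (Fin d)}
    (hz : z ∈ Metric.closedBall (0 : EuclideanSpace ℝ (Fin d)) (D / 2)) :
    r.vLow S.regularization (i + 1) (t + 1) m ≤ S.parentCost t z
      + inner ℝ (r.lam (i + 1) (t + 1) m) (r.x (i + 1) t - z)
      + nodeValue r (i + 1) (t + 1) m := by
  obtain ⟨x, hx, hxv⟩ := exists_eq_nodeValue hr hD (i := i + 1) hi (t := t + 1) (by omega) hT m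
  have h := (hr.backward i hi (t + 1) (by omega) hT m).2.2.2.1 x hx z hz
  have h2 := rho_eq_zero hr hi (t := t + 1) (by omega) hT m
  rw [h2, backwardObj_eq S _ _ _ _ _ x z, Nat.add_sub_cancel] at h
  have h3 : r.vLow S.regularization (i + 1) (t + 1) m = backwardObj S.regularization (t + 1) m
    (r.x (i + 1) t) (r.underQ (i + 1) (t + 1)) (r.lam (i + 1) (t + 1) m) 0
    (r.xB (i + 1) (t + 1) m) (r.zB (i + 1) (t + 1) m) := by
    rw [← h2]
    rfl
  linarith

theorem cut_le {i t : ℕ} (hD : 0 < D) (hi : i < n) (hT : t < T) (m : Fin (S.K (t + 1)))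
    {y : EuclideanSpace ℝ (Fin d)}
    (hy : y ∈ Metric.closedBall (0 : EuclideanSpace ℝ (Fin d)) (D / 2)) :
    r.cut S.regularization (i + 1) (t + 1) m y ≤
      S.parentCost t y + nodeValue r (i + 1) (t + 1) m := by
  rw [cut_eq hr hi hT]
  have := vLow_le hr hD hi hT m hy
  linarith

/-- The slope of piece k has norm exactly L_{t+1}, so it is an admissible multiplier; its inner
minimum is bounded below because F_t lies above piece k. -/
theorem le_vLow {i t : ℕ} (hD : 0 < D) (hL : 0 < L) (hi : i < n) (h1 : 1 ≤ t) (hT : t < T)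
    (m : Fin (S.K (t + 1))) {k : Fin (S.K t)} (hk : r.x (i + 1) t = S.w t k) :
    S.v t k + nodeValue r (i + 1) (t + 1) m ≤ r.vLow S.regularization (i + 1) (t + 1) m := by
  have hl := S.lip_pos hL (t := t + 1) (by omega) hT
  obtain ⟨x, -, z, -, h⟩ := (hr.backward i hi (t + 1) (by omega) hT m).2.2.2.2
    ((S.lip (t + 1) / (D / 2)) • S.w t k, 0) ⟨by
      change ‖(S.lip (t + 1) / (D / 2)) • S.w t k‖ ≤ S.lip (t + 1)
      rw [norm_smul, S.norm_w h1 hT, Real.norm_of_nonneg (by positivity)]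
      exact (div_mul_cancel₀ _ (by positivity)).le, le_rfl, le_rfl⟩
  rw [backwardObj_eq S, Nat.add_sub_cancel, hk] at h
  have h2 := nodeValue_le hr hL (i := i + 1) hi (t := t + 1) (by omega) hT m x
  have h3 := S.piece_le_F t k z
  have h4 : S.parentCost t z = S.F t z := by simp [parentCost, show t ≠ 0 by omega]
  have h5 : r.vLow S.regularization (i + 1) (t + 1) m = backwardObj S.regularization (t + 1) m
    (S.w t k) (r.underQ (i + 1) (t + 1)) (r.lam (i + 1) (t + 1) m) (r.rho (i + 1) (t + 1) m)
    (r.xB (i + 1) (t + 1) m) (r.zB (i + 1) (t + 1) m) := by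
    rw [← hk]
    rfl
  have h6 : inner ℝ (S.w t k) (S.w t k - z) = - inner ℝ (S.w t k) (z - S.w t k) := by
    rw [← inner_neg_right, neg_sub]
  rw [inner_smul_left, h6] at h
  simp only [piece] at h3
  simp only [conj_trivial] at h
  linarith

/-- An optimal multiplier λ does at least as well as the slope of piece k. Testing its inner minimum
on the segment towards w_{t,j}, where F_t decreases at rate at least ε/(T-1), forces ⟨λ, w_{t,k} -
w_{t,j}⟩ ≥ ε/(T-1) > v_{t,k}. The cut therefore loses all of v_{t,k} on the way to w_{t,j}. -/
theorem cut_le_of_ne {i t : ℕ} (hT2 : 2 ≤ T) (hD : 0 < D) (hL : 0 < L) (hε : 0 < ε) (hi : i < n)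
    (h1 : 1 ≤ t) (hT : t < T) (m : Fin (S.K (t + 1))) {j k : Fin (S.K t)}
    (hk : r.x (i + 1) t = S.w t k) (hjk : j ≠ k) :
    r.cut S.regularization (i + 1) (t + 1) m (S.w t j) ≤ nodeValue r (i + 1) (t + 1) m := by
  obtain ⟨s, hs0, hs1, hs⟩ := S.exists_F_segment_le hD hL hT2 hε h1 hT hjk
  have hz : S.w t k + s • (S.w t j - S.w t k) ∈
      Metric.closedBall (0 : EuclideanSpace ℝ (Fin d)) (D / 2) :=
    (convex_closedBall _ _).add_smul_sub_mem (S.w_mem h1 hT k) (S.w_mem h1 hT j) ⟨hs0.le, hs1⟩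
  have h2 := le_vLow hr hD hL hi h1 hT m hk
  have h3 := vLow_le hr hD hi hT m hz
  have h4 := vLow_le hr hD hi hT m (S.w_mem h1 hT k)
  have h5 := S.v_lt h1 hT k
  have h6 : ∀ z, S.parentCost t z = S.F t z := by simp [parentCost, show t ≠ 0 by omega]
  rw [h6, hk] at h3 h4
  rw [sub_self, inner_zero_right, S.F_w hD hL hT2 hε h1 hT] at h4
  rw [cut_eq hr hi hT, hk]
  have h7 : S.w t k - (S.w t k + s • (S.w t j - S.w t k)) = s • (S.w t k - S.w t j) := by
    module
  rw [h7, inner_smul_right] at h3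
  have h8 : ε / ((T : ℝ) - 1) ≤ inner ℝ (r.lam (i + 1) (t + 1) m) (S.w t k - S.w t j) := by
    by_contra hcon
    nlinarith
  linarith

end Lower

end SphericalCapExample

/-! ### Visited nodes, and upper bounds on the under-approximations. -/

namespace SphericalCapExample

open Finset StagewiseProblem

variable {d T : ℕ} {L D ε : ℝ} {S : SphericalCapExample d T L D ε} {n : ℕ} {r : S.problem.Run}

open Classical in
/-- The nodes of stage `t` whose state was sampled in the first `i` iterations. -/
noncomputable def visited (r : S.problem.Run) (i t : ℕ) : Finset (Fin (S.K t)) :=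
  {k | ∃ j < i, r.x (j + 1) t = S.w t k}

theorem mem_visited {i t : ℕ} {k : Fin (S.K t)} :
    k ∈ visited r i t ↔ ∃ j < i, r.x (j + 1) t = S.w t k := by
  simp [visited]

theorem visited_mono {i j : ℕ} (h : i ≤ j) (t : ℕ) : visited r i t ⊆ visited r j t := by
  intro k hk
  rw [mem_visited] at hk ⊢
  obtain ⟨a, ha, hk⟩ := hk
  exact ⟨a, ha.trans_le h, hk⟩

theorem card_visited_le (i : ℕ) {t : ℕ} (h1 : 1 ≤ t) (hT : t < T) : #(visited r i t) ≤ i := by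
  classical
  rw [← card_image_of_injective _ (S.packing t h1 hT).injective]
  calc #((visited r i t).image (S.w t)) ≤ #((range i).image fun j => r.x (j + 1) t) := by
        refine card_le_card fun y hy => ?_
        obtain ⟨k, hk, rfl⟩ := mem_image.1 hy
        obtain ⟨j, hj, h⟩ := mem_visited.1 hk
        exact mem_image.2 ⟨j, mem_range.2 hj, h⟩
    _ ≤ i := card_image_le.trans (card_range i).le

/-- The sum over the stages after `t` of the averages over the nodes. -/
noncomputable def level (S : SphericalCapExample d T L D ε) (a : (t : ℕ) → Fin (S.K t) → ℝ)
    (t : ℕ) : ℝ :=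
  ∑ s ∈ Ioo t T, ∑ k, 1 / (S.K s : ℝ) * a s k

theorem level_of_lt (a : (t : ℕ) → Fin (S.K t) → ℝ) {t : ℕ} (h : t + 1 < T) :
    S.level a t = ∑ k, 1 / (S.K (t + 1) : ℝ) * a (t + 1) k + S.level a (t + 1) := by
  have : Ioo t T = insert (t + 1) (Ioo (t + 1) T) := by
    ext s
    simp only [mem_Ioo, mem_insert]
    omega
  rw [level, this, sum_insert (by simp)]
  rfl

theorem level_of_le (a : (t : ℕ) → Fin (S.K t) → ℝ) {t : ℕ} (h : T ≤ t + 1) :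
    S.level a t = 0 := by
  have : Ioo t T = ∅ := by
    ext s
    simp only [mem_Ioo, notMem_empty, iff_false]
    omega
  rw [level, this, sum_empty]

theorem level_mono {a b : (t : ℕ) → Fin (S.K t) → ℝ}
    (h : ∀ t, 1 ≤ t → t < T → ∀ k, a t k ≤ b t k) (t : ℕ) : S.level a t ≤ S.level b t := by
  refine sum_le_sum fun s hs => sum_le_sum fun k _ => ?_
  rw [mem_Ioo] at hs
  exact mul_le_mul_of_nonneg_left (h s (by omega) hs.2 k) (by positivity)

open Classical in
/-- Upper bound on the contribution of a node to the under-approximation. -/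
noncomputable def lowVal (r : S.problem.Run) (i t : ℕ) (k : Fin (S.K t)) : ℝ :=
  if k ∈ visited r i t then S.v t k else 0

open Classical in
/-- Lower bound on the contribution of a node to the over-approximation. -/
noncomputable def upVal (r : S.problem.Run) (i t : ℕ) (k : Fin (S.K t)) : ℝ :=
  -- A drop of ε/(T-1) from this value leaves ε/(2(T-1)), which is below every v.
  if k ∈ visited r i t then S.v t k else 3 / 2 * (ε / ((T : ℝ) - 1))

section

variable (hT2 : 2 ≤ T) (hε : 0 < ε)
include hT2 hε

theorem lowVal_nonneg (i : ℕ) {t : ℕ} (h1 : 1 ≤ t) (hT : t < T) (k : Fin (S.K t)) :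
    0 ≤ lowVal r i t k := by
  have := S.v_pos hT2 hε h1 hT k
  unfold lowVal
  split_ifs <;> linarith

theorem lowVal_mono {i j : ℕ} (hij : i ≤ j) {t : ℕ} (h1 : 1 ≤ t) (hT : t < T) (k : Fin (S.K t)) :
    lowVal r i t k ≤ lowVal r j t k := by
  have h2 := S.v_pos hT2 hε h1 hT k
  have h3 := @visited_mono _ _ _ _ _ S r _ _ hij t k
  unfold lowVal
  split_ifs with h4 h5
  · exact le_rfl
  · exact absurd (h3 h4) h5
  · exact h2.le
  · exact le_rfl

omit hT2 hε in
theorem upVal_anti {i j : ℕ} (hij : i ≤ j) {t : ℕ} (h1 : 1 ≤ t) (hT : t < T) (k : Fin (S.K t)) :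
    upVal r j t k ≤ upVal r i t k := by
  have h2 := S.v_lt h1 hT k
  have h3 := @visited_mono _ _ _ _ _ S r _ _ hij t k
  have h6 := S.lt_v h1 hT k
  unfold upVal
  split_ifs with h4 h5 h5
  · exact le_rfl
  · linarith
  · exact absurd (h3 h5) h4
  · exact le_rfl

variable (hD : 0 < D) (hL : 0 < L) (hr : r.IsRun S.regularization n)
include hD hL hr

/-- Upper bounds on the under-approximations in terms of the visited nodes. -/
def UnderBound (r : S.problem.Run) (i t : ℕ) : Prop :=
  (1 ≤ t → ∀ k, r.underQ i t (S.w t k) ≤ lowVal r i t k + S.level (lowVal r i) t) ∧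
    (t = 0 → ∀ y ∈ Metric.closedBall (0 : EuclideanSpace ℝ (Fin d)) (D / 2),
      r.underQ i 0 y ≤ S.level (lowVal r i) 0)

omit hD hL in
theorem underBound_zero {t : ℕ} (hT : t < T) : UnderBound r 0 t := by
  have h2 : 0 ≤ S.level (lowVal r 0) t := by
    refine sum_nonneg fun s hs => sum_nonneg fun k _ => ?_
    rw [mem_Ioo] at hs
    exact mul_nonneg (by positivity) (lowVal_nonneg hT2 hε 0 (by omega) hs.2 k)
  refine ⟨fun h1 k => ?_, fun h1 y _ => ?_⟩
  · have h3 := lowVal_nonneg hT2 hε (r := r) 0 h1 hT k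
    rw [hr.under_zero t hT.le]
    linarith
  · subst h1
    rwa [hr.under_zero 0 hT.le]

omit hT2 hε hD hL hr in
theorem sum_nodeValue_le {i t : ℕ} (hT : t < T) (h : t + 1 < T → UnderBound r i (t + 1)) :
    ∑ m, 1 / (S.K (t + 1) : ℝ) * nodeValue r i (t + 1) m ≤ S.level (lowVal r i) t := by
  rcases (show t + 1 ≤ T from hT).lt_or_eq with h1 | h1
  · rw [level_of_lt _ h1]
    refine sum_one_div_mul_le (S.K_pos' (by omega) hT) fun m => ?_
    simp only [nodeValue, h1.ne, if_false]
    exact (h h1).1 (by omega) m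
  · rw [level_of_le _ h1.ge]
    simp [nodeValue, h1]

/-- Only the new cut needs an argument: it reaches v_{t,k} plus the later levels at the sampled
point, and no more than the later levels at other packing points. Stage 1 has no parent cost, so at
the root the bound holds on the whole ball. -/
theorem underBound_succ {i t : ℕ} (hi : i < n) (hT : t < T) (h : UnderBound r i t)
    (h' : t + 1 < T → UnderBound r (i + 1) (t + 1)) : UnderBound r (i + 1) t := by
  have h2 := sum_nodeValue_le hT h'
  have hK := S.K_pos' (t := t + 1) (by omega) hT
  have hlev : S.level (lowVal r i) t ≤ S.level (lowVal r (i + 1)) t :=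
    level_mono (fun s hs hs' k => lowVal_mono hT2 hε (Nat.le_succ i) hs hs' k) t
  refine ⟨fun h1 k => ?_, fun h1 y hy => ?_⟩
  · rw [underQ_step hr hi hT]
    refine max_le ?_ ?_
    · have h3 := lowVal_mono hT2 hε (r := r) (Nat.le_succ i) h1 hT k
      have h4 := h.1 h1 k
      linarith
    · obtain ⟨k', hk'⟩ := exists_x_eq hr hL hi h1 hT
      rw [add_comm (lowVal r (i + 1) t k)]
      refine (sum_one_div_mul_le hK (c := lowVal r (i + 1) t k) fun m => ?_).trans
        (add_le_add_left h2 _)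
      by_cases hkk : k = k'
      · have hv : lowVal r (i + 1) t k = S.v t k := by
          have : k ∈ visited r (i + 1) t := mem_visited.2 ⟨i, Nat.lt_succ_self i, by rw [hkk, hk']⟩
          simp [lowVal, this]
        have h5 := cut_le hr hD hi hT m (S.w_mem h1 hT k)
        have h6 : S.parentCost t (S.w t k) = S.v t k := by
          rw [← S.F_w hD hL hT2 hε h1 hT k]
          simp [parentCost, show t ≠ 0 by omega]
        linarith
      · have h5 := cut_le_of_ne hr hT2 hD hL hε hi h1 hT m hk' hkk
        have h6 := lowVal_nonneg hT2 hε (r := r) (i + 1) h1 hT k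
        linarith
  · subst h1
    rw [underQ_step hr hi hT]
    refine max_le ((h.2 rfl y hy).trans hlev) (le_trans ?_ h2)
    rw [← add_zero (∑ m, 1 / (S.K (0 + 1) : ℝ) * nodeValue r (i + 1) (0 + 1) m)]
    refine sum_one_div_mul_le hK fun m => ?_
    have := cut_le hr hD hi hT m hy
    simp only [parentCost, if_true] at this
    linarith

theorem underBound {i t : ℕ} (hi : i ≤ n) (hT : t < T) : UnderBound r i t := by
  induction i generalizing t with
  | zero => exact underBound_zero hT2 hε hr hT
  | succ i ih =>
    -- Within an iteration the induction follows the backward pass, from stage T - 1 down; j counts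
    -- the steps left.
    obtain ⟨j, hj⟩ : ∃ j, t + 1 + j = T := ⟨T - (t + 1), by omega⟩
    induction j generalizing t with
    | zero =>
      exact underBound_succ hT2 hε hD hL hr hi hT (ih (by omega) hT) fun h => absurd h (by omega)
    | succ j ihj =>
      exact underBound_succ hT2 hε hD hL hr hi hT (ih (by omega) hT)
        fun h => ihj h (by omega)

theorem lower_le : r.lower n ≤ S.level (lowVal r n) 0 := by
  rw [hr.lower_eq n le_rfl]
  have := (underBound hT2 hε hD hL hr le_rfl (show 0 < T by omega)).2 rfl _ (hr.root_mem n le_rfl)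
  simpa [problem] using this

end

/-! ### Lower bounds on the over-approximations, and the gap. -/

theorem le_convMin {f g : EuclideanSpace ℝ (Fin d) → EReal} {c : ℝ}
    {lam : EuclideanSpace ℝ (Fin d)} (hf : ∀ z, ((c + inner ℝ lam z : ℝ) : EReal) ≤ f z)
    (hg : ∀ z, ((c + inner ℝ lam z : ℝ) : EReal) ≤ g z) (x : EuclideanSpace ℝ (Fin d)) :
    ((c + inner ℝ lam x : ℝ) : EReal) ≤ convMin f g x := by
  -- In the biconjugate, the slope of the common affine minorant already gives the bound.
  refine le_iSup_of_le lam (le_iInf fun z => ?_)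
  refine le_trans (le_of_eq ?_) (add_le_add_left (le_min (hf z) (hg z)) _)
  rw [← EReal.coe_add, inner_sub_right]
  congr 1
  ring

theorem coe_sum_le {ι : Type*} (s : Finset ι) {f : ι → ℝ} {g : ι → EReal}
    (h : ∀ m ∈ s, ((f m : ℝ) : EReal) ≤ g m) : ((∑ m ∈ s, f m : ℝ) : EReal) ≤ ∑ m ∈ s, g m := by
  classical
  induction s using Finset.induction_on with
  | empty => simp
  | insert a s ha ih =>
    rw [sum_insert ha, sum_insert ha, EReal.coe_add]
    exact add_le_add (h a (mem_insert_self a s)) (ih fun m hm => h m (mem_insert_of_mem hm))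

section Upper

variable (hT2 : 2 ≤ T) (hε : 0 < ε) (hD : 0 < D) (hL : 0 < L) (hr : r.IsRun S.regularization n)
include hT2 hε hD hL hr

/-- Lower bounds on the over-approximations in terms of the visited nodes. -/
def OverBound (r : S.problem.Run) (i t : ℕ) : Prop :=
  (1 ≤ t → ∀ k z, ((upVal r i t k + S.level (upVal r i) t
      + S.lip (t + 1) / (D / 2) * inner ℝ (S.w t k) (z - S.w t k) : ℝ) : EReal) ≤ r.overQ i t z) ∧
    (t = 0 → ∀ z, ((S.level (upVal r i) 0 : ℝ) : EReal) ≤ r.overQ i 0 z)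

omit hT2 hε hD hL in
theorem overBound_zero {t : ℕ} (hT : t < T) : OverBound r 0 t := by
  refine ⟨fun h1 k z => ?_, fun h1 z => ?_⟩
  · rw [hr.over_zero t hT]
    exact le_top
  · rw [hr.over_zero 0 (by subst h1; exact hT)]
    exact le_top

omit hT2 hε hD in
/-- Lower bound on a newly generated piece of the over-approximation, where `c` bounds the
regularized parent cost at the sampled state from below. -/
theorem le_overNew {i t : ℕ} (hi : i < n) (hT : t < T)
    (h : t + 1 < T → OverBound r (i + 1) (t + 1)) {c : ℝ}
    (hc : ∀ z, c ≤ S.parentCost t z + S.lip (t + 1) * ‖r.x (i + 1) t - z‖)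
    (y : EuclideanSpace ℝ (Fin d)) :
    ((c + S.level (upVal r (i + 1)) t + S.lip (t + 1) * ‖y - r.x (i + 1) t‖ : ℝ) : EReal)
      ≤ r.overNew S.regularization (i + 1) t y := by
  have hl := S.lip_pos hL (t := t + 1) (by omega) hT
  have hK : 0 < S.K (t + 1) := S.K_pos' (by omega) hT
  have hK' : (0 : ℝ) < S.K (t + 1) := by exact_mod_cast hK
  -- Lower bound for the over-approximation at the state chosen by node m; it is 0 in the last
  -- stage, where no cost-to-go remains.
  set ℓ : Fin (S.K (t + 1)) → ℝ := fun m => if t + 1 = T then 0 else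
    upVal r (i + 1) (t + 1) m + S.level (upVal r (i + 1)) (t + 1) with hℓ
  have hsum : ∑ m, 1 / (S.K (t + 1) : ℝ) *
      (ℓ m + (c + S.lip (t + 1) * ‖y - r.x (i + 1) t‖)) =
      c + S.level (upVal r (i + 1)) t + S.lip (t + 1) * ‖y - r.x (i + 1) t‖ := by
    simp only [mul_add, sum_add_distrib, sum_const, card_univ, Fintype.card_fin, nsmul_eq_mul]
    have h3 : ∑ m, 1 / (S.K (t + 1) : ℝ) * ℓ m = S.level (upVal r (i + 1)) t := by
      rcases (show t + 1 ≤ T from hT).lt_or_eq with h1 | h1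
      · simp only [hℓ, h1.ne, if_false, level_of_lt _ h1, mul_add, sum_add_distrib, sum_const,
          card_univ, Fintype.card_fin, nsmul_eq_mul]
        field_simp
      · simp [hℓ, h1, level_of_le _ h1.ge]
    rw [h3]
    field_simp
    ring
  rw [← hsum]
  refine coe_sum_le _ fun m _ => ?_
  rw [EReal.coe_mul]
  refine mul_le_mul_of_nonneg_left ?_ (EReal.coe_nonneg.2 (by positivity))
  have hov : ((ℓ m : ℝ) : EReal) ≤ r.overQ (i + 1) (t + 1) (r.xF (i + 1) (t + 1) m) := by
    rcases (show t + 1 ≤ T from hT).lt_or_eq with h1 | h1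
    · have h4 := (h h1).1 (by omega) m (r.xF (i + 1) (t + 1) m)
      rw [xF_eq hr hL hi (by omega) h1, sub_self, inner_zero_right, mul_zero, add_zero] at h4
      simp only [hℓ, h1.ne, if_false]
      rwa [xF_eq hr hL hi (by omega) h1]
    · have h4 := hr.over_last (i + 1) hi (r.xF (i + 1) (t + 1) m)
      change r.overQ (i + 1) T _ = 0 at h4
      simp only [hℓ, h1, if_true]
      subst h1
      rw [h4]
      simp
  have hz := hc (r.zF (i + 1) (t + 1) m)
  have hst : 0 ≤ S.stateCost (t + 1) m (r.xF (i + 1) (t + 1) m) := by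
    unfold stateCost
    split_ifs
    · exact le_rfl
    · positivity
  have hv : ((c + ℓ m : ℝ) : EReal) ≤ r.vUp S.regularization (i + 1) (t + 1) m := by
    rw [EReal.coe_add]
    refine add_le_add (EReal.coe_le_coe_iff.2 ?_) hov
    rw [S.problem_f, Nat.add_sub_cancel]
    change c ≤ _ + S.lip (t + 1) * ‖r.x (i + 1) t - r.zF (i + 1) (t + 1) m‖
    linarith
  refine le_trans (le_of_eq ?_) (add_le_add_left hv _)
  rw [← EReal.coe_add]
  congr 1
  change _ = c + ℓ m + S.lip (t + 1) * ‖y - r.x (i + 1) t‖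
  ring

/-- The biconjugate keeps every affine function lying below both arguments, so it remains to place
the minorant of node k below the new cone with apex at the sampled point w_{t,k'}. -/
theorem overBound_succ {i t : ℕ} (hi : i < n) (hT : t < T) (h : OverBound r i t)
    (h' : t + 1 < T → OverBound r (i + 1) (t + 1)) : OverBound r (i + 1) t := by
  have hl := S.lip_pos hL (t := t + 1) (by omega) hT
  have hlev : S.level (upVal r (i + 1)) t ≤ S.level (upVal r i) t :=
    level_mono (fun s hs hs' k => upVal_anti (Nat.le_succ i) hs hs' k) t
  have hstep := hr.over_step_convex (S.problem_isConvex hL) i hi t hT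
  refine ⟨fun h1 k z => ?_, fun h1 z => ?_⟩
  · rw [hstep]
    obtain ⟨k', hk'⟩ := exists_x_eq hr hL hi h1 hT
    have haff : ∀ y, upVal r (i + 1) t k + S.level (upVal r (i + 1)) t
        + S.lip (t + 1) / (D / 2) * inner ℝ (S.w t k) (y - S.w t k) =
        (upVal r (i + 1) t k + S.level (upVal r (i + 1)) t
        - S.lip (t + 1) / (D / 2) * inner ℝ (S.w t k) (S.w t k))
        + inner ℝ ((S.lip (t + 1) / (D / 2)) • S.w t k) y := by
      intro y
      rw [inner_smul_left, inner_sub_right]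
      simp only [conj_trivial]
      ring
    rw [haff]
    refine le_convMin (fun y => ?_) (fun y => ?_) z
    · rw [← haff]
      refine le_trans (EReal.coe_le_coe_iff.2 ?_) (h.1 h1 k y)
      have := upVal_anti (r := r) (Nat.le_succ i) h1 hT k
      linarith
    · rw [← haff]
      have hc : ∀ z, S.v t k' ≤ S.parentCost t z + S.lip (t + 1) * ‖r.x (i + 1) t - z‖ := by
        intro z
        rw [hk', ← S.F_w hD hL hT2 hε h1 hT k']
        simpa [parentCost, show t ≠ 0 by omega] using S.F_sub_le hD hL h1 hT (S.w t k') z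
      refine le_trans (EReal.coe_le_coe_iff.2 ?_) (le_overNew hL hr hi hT h' hc y)
      rw [hk']
      -- Minorant and cone need only be compared at the apex: beyond it the minorant grows with
      -- slope at most L_{t+1}, which is the slope of the cone.
      have h5 := S.slope_inner_le hD hL h1 hT k (y - S.w t k')
      have h6 : inner ℝ (S.w t k) (y - S.w t k) = inner ℝ (S.w t k) (y - S.w t k')
          + inner ℝ (S.w t k) (S.w t k' - S.w t k) := by
        rw [← inner_add_right]
        congr 1
        abel
      rw [h6, mul_add]
      by_cases hkk : k' = k
      · have hv : upVal r (i + 1) t k = S.v t k' := by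
          have : k ∈ visited r (i + 1) t := mem_visited.2 ⟨i, Nat.lt_succ_self i, by rw [← hkk, hk']⟩
          simp [upVal, this, hkk]
        rw [hv, hkk, sub_self, inner_zero_right, mul_zero]
        rw [hkk] at h5
        linarith
      · have h7 := S.slope_inner_lt hD hL hT2 h1 hT hkk
        have h8 : upVal r (i + 1) t k ≤ 3 / 2 * (ε / ((T : ℝ) - 1)) := by
          have h9 := S.v_lt h1 hT k
          have h10 := S.v_pos hT2 hε h1 hT k
          unfold upVal
          split_ifs <;> linarith
        have h9 := S.lt_v h1 hT k'
        linarith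
  · subst h1
    rw [hstep]
    -- At the root there is no parent cost and the minorant is constant.
    have := le_convMin (c := S.level (upVal r (i + 1)) 0) (lam := 0) (f := r.overQ i 0)
      (g := r.overNew S.regularization (i + 1) 0) (fun y => ?_) (fun y => ?_) z
    · simpa using this
    · rw [inner_zero_left, add_zero]
      exact le_trans (EReal.coe_le_coe_iff.2 hlev) (h.2 rfl y)
    · rw [inner_zero_left, add_zero]
      have hc : ∀ z, 0 ≤ S.parentCost 0 z + S.lip (0 + 1) * ‖r.x (i + 1) 0 - z‖ := by
        intro z
        simp only [parentCost, if_true, zero_add]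
        positivity
      refine le_trans (EReal.coe_le_coe_iff.2 ?_) (le_overNew hL hr hi hT h' hc y)
      have : 0 ≤ S.lip (0 + 1) * ‖y - r.x (i + 1) 0‖ := by positivity
      linarith

theorem overBound {i t : ℕ} (hi : i ≤ n) (hT : t < T) : OverBound r i t := by
  induction i generalizing t with
  | zero => exact overBound_zero hr hT
  | succ i ih =>
    obtain ⟨j, hj⟩ : ∃ j, t + 1 + j = T := ⟨T - (t + 1), by omega⟩
    induction j generalizing t with
    | zero =>
      exact overBound_succ hT2 hε hD hL hr hi hT (ih (by omega) hT) fun h => absurd h (by omega)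
    | succ j ihj =>
      exact overBound_succ hT2 hε hD hL hr hi hT (ih (by omega) hT)
        fun h => ihj h (by omega)

theorem le_upper {i : ℕ} (hi : i ≤ n) : ((S.level (upVal r i) 0 : ℝ) : EReal) ≤ r.upper i := by
  induction i with
  | zero =>
    rw [hr.upper_zero]
    exact le_top
  | succ i ih =>
    rw [hr.upper_step i hi]
    refine le_min (le_trans (EReal.coe_le_coe_iff.2 ?_) (ih (by omega))) ?_
    · exact level_mono (fun s hs hs' k => upVal_anti (Nat.le_succ i) hs hs' k) 0
    · have h := (overBound hT2 hε hD hL hr hi (show 0 < T by omega)).2 rfl (r.x (i + 2) 0)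
      change _ ≤ ((0 : ℝ) : EReal) + _
      rwa [EReal.coe_zero, zero_add]

/-- If the algorithm has closed the gap, then in some stage more than a third of the nodes have been
visited. -/
theorem exists_card_lt_of_gap_lt (hgap : r.upper n - ((r.lower n : ℝ) : EReal) < (ε : EReal)) :
    ∃ t, 1 ≤ t ∧ t < T ∧ (S.K t : ℝ) < 3 * n := by
  by_contra! hcon
  have hTr : (0 : ℝ) < (T : ℝ) - 1 := by
    have : (2 : ℝ) ≤ T := by exact_mod_cast hT2
    linarith
  have h1 : ((S.level (upVal r n) 0 - r.lower n : ℝ) : EReal) ≤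
      r.upper n - ((r.lower n : ℝ) : EReal) := by
    rw [EReal.coe_sub]
    exact EReal.sub_le_sub (le_upper hT2 hε hD hL hr le_rfl) le_rfl
  have h2 := EReal.coe_lt_coe_iff.1 (h1.trans_lt hgap)
  have h3 := lower_le hT2 hε hD hL hr
  have h4 : ε ≤ S.level (upVal r n) 0 - S.level (lowVal r n) 0 := by
    rw [level, level, ← sum_sub_distrib]
    have hb : ∀ s ∈ Ioo 0 T, ε / ((T : ℝ) - 1) ≤ ∑ k, 1 / (S.K s : ℝ) * upVal r n s k
        - ∑ k, 1 / (S.K s : ℝ) * lowVal r n s k := by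
      intro s hs
      rw [mem_Ioo] at hs
      have hK : (0 : ℝ) < S.K s := by exact_mod_cast S.K_pos' hs.1 hs.2.le
      have hc1 : (#(visited r n s) : ℝ) ≤ n := by exact_mod_cast card_visited_le n hs.1 hs.2
      have hc2 := hcon s hs.1 hs.2
      -- The two values cancel at visited nodes and differ by 3/2·ε/(T-1) at the others.
      have hd : ∀ k, 1 / (S.K s : ℝ) * upVal r n s k - 1 / (S.K s : ℝ) * lowVal r n s k =
          1 / (S.K s : ℝ) * (3 / 2 * (ε / ((T : ℝ) - 1))) *
          (1 - if k ∈ visited r n s then 1 else 0) := by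
        intro k
        unfold upVal lowVal
        split_ifs <;> ring
      rw [← sum_sub_distrib, sum_congr rfl fun k _ => hd k, ← mul_sum, sum_sub_distrib]
      simp only [sum_const, card_univ, Fintype.card_fin, nsmul_eq_mul, mul_one, sum_boole,
        filter_univ_mem]
      have he : 0 < ε / ((T : ℝ) - 1) := by positivity
      rw [show 1 / (S.K s : ℝ) * (3 / 2 * (ε / ((T : ℝ) - 1))) * (S.K s - #(visited r n s)) =
        (ε / ((T : ℝ) - 1)) * (3 / 2 * (S.K s - #(visited r n s)) / S.K s) by ring]
      -- At most n ≤ K_s/3 nodes are visited, so 3/2 times the unvisited fraction is at least 1.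
      refine le_mul_of_one_le_right he.le ?_
      rw [le_div_iff₀ hK]
      linarith
    calc ε = ∑ s ∈ Ioo 0 T, ε / ((T : ℝ) - 1) := by
          rw [sum_const, Nat.card_Ioo, nsmul_eq_mul, Nat.sub_zero, Nat.cast_sub (by omega)]
          field_simp
          simp
      _ ≤ _ := sum_le_sum hb
  linarith

omit hT2 hε hD hL in
theorem pos_of_gap_lt (hgap : r.upper n - ((r.lower n : ℝ) : EReal) < (ε : EReal)) : 0 < n := by
  rcases Nat.eq_zero_or_pos n with rfl | h
  · rw [hr.upper_zero, EReal.top_sub_coe] at hgap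
    exact absurd hgap (by simp)
  · exact h

end Upper

end SphericalCapExample

/-! ### Large cap packings by volume comparison. -/

/-- The volume of the unit ball of dimension `m`. -/
noncomputable def unitBallVolume (m : ℕ) : ℝ := √Real.pi ^ m / Real.Gamma ((m : ℝ) / 2 + 1)

theorem unitBallVolume_pos (m : ℕ) : 0 < unitBallVolume m :=
  div_pos (pow_pos (Real.sqrt_pos.2 Real.pi_pos) m) (Real.Gamma_pos_of_pos (by positivity))

theorem unitBallVolume_succ (m : ℕ) : unitBallVolume (m + 1) =
    √Real.pi * (Real.Gamma ((m : ℝ) / 2 + 1) / Real.Gamma ((m : ℝ) / 2 + 3 / 2))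
      * unitBallVolume m := by
  have h : Real.Gamma ((m : ℝ) / 2 + 1) ≠ 0 := (Real.Gamma_pos_of_pos (by positivity)).ne'
  have h2 : ((m + 1 : ℕ) : ℝ) / 2 + 1 = (m : ℝ) / 2 + 3 / 2 := by
    push_cast
    ring
  rw [unitBallVolume, unitBallVolume, h2, pow_succ]
  field_simp

/-- The intersection of the unit ball with the circular cone around `u` with cosine `c`. -/
def ballSector {d : ℕ} (c : ℝ) (u : EuclideanSpace ℝ (Fin d)) :
    Set (EuclideanSpace ℝ (Fin d)) :=
  {x | ‖x‖ ≤ 1 ∧ c * ‖x‖ ≤ inner ℝ u x}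

/-- Any isometry can be corrected by the reflection that swaps the image of the first axis with u.
This makes u a coordinate axis for Fubini. -/
theorem exists_linearIsometryEquiv_prod {m : ℕ} (u : EuclideanSpace ℝ (Fin (m + 1)))
    (hu : ‖u‖ = 1) :
    ∃ φ : WithLp 2 (ℝ × EuclideanSpace ℝ (Fin m)) ≃ₗᵢ[ℝ] EuclideanSpace ℝ (Fin (m + 1)),
      φ (WithLp.toLp 2 (1, 0)) = u := by
  have hf : Module.finrank ℝ (WithLp 2 (ℝ × EuclideanSpace ℝ (Fin m))) = m + 1 := by
    rw [LinearEquiv.finrank_eq (WithLp.linearEquiv 2 ℝ (ℝ × EuclideanSpace ℝ (Fin m)))]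
    simp
    omega
  set ψ : WithLp 2 (ℝ × EuclideanSpace ℝ (Fin m)) ≃ₗᵢ[ℝ] EuclideanSpace ℝ (Fin (m + 1)) :=
    ((stdOrthonormalBasis ℝ (WithLp 2 (ℝ × EuclideanSpace ℝ (Fin m)))).reindex (finCongr hf)).repr
  have hψ : ‖ψ (WithLp.toLp 2 (1, 0))‖ = ‖u‖ := by
    rw [ψ.norm_map, hu, ← sq_eq_sq₀ (norm_nonneg _) zero_le_one, WithLp.prod_norm_sq_eq_of_L2]
    simp
  exact ⟨ψ.trans ((Submodule.span ℝ {ψ (WithLp.toLp 2 (1, 0)) - u})ᗮ.reflection),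
    Submodule.reflection_sub hψ⟩

open MeasureTheory

/-- Radius of a ball that contains the slice at height `t` of a sector of the unit ball. -/
noncomputable def sectorRadius (c t : ℝ) : ℝ :=
  -- Up to height c the cone limits the slice. Above it the ball does, with radius √(1 - t²)
  -- enlarged to √(2 - 2t), whose powers integrate in closed form.
  if t ≤ c then √(1 - c ^ 2) / c * t else √(2 - 2 * t)

theorem sector_slice {c t y : ℝ} (hc : 0 < c) (hc1 : c < 1)
    (h1 : √(t ^ 2 + y ^ 2) ≤ 1) (h2 : c * √(t ^ 2 + y ^ 2) ≤ t) :
    t ∈ Set.Icc 0 1 ∧ y ≤ sectorRadius c t := by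
  have hs := Real.sqrt_nonneg (t ^ 2 + y ^ 2)
  have ht : 0 ≤ t := le_trans (by positivity) h2
  have hsq : √(t ^ 2 + y ^ 2) ^ 2 = t ^ 2 + y ^ 2 := Real.sq_sqrt (by positivity)
  have ht1 : t ^ 2 + y ^ 2 ≤ 1 := by nlinarith
  have ht2 : t ≤ 1 := by nlinarith
  refine ⟨⟨ht, ht2⟩, ?_⟩
  unfold sectorRadius
  split_ifs with h
  · rw [div_mul_eq_mul_div, le_div_iff₀ hc]
    have h3 : (y * c) ^ 2 ≤ (√(1 - c ^ 2) * t) ^ 2 := by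
      rw [mul_pow, mul_pow, Real.sq_sqrt (by nlinarith)]
      have : c ^ 2 * (t ^ 2 + y ^ 2) ≤ t ^ 2 := by
        rw [← hsq, ← mul_pow]
        exact pow_le_pow_left₀ (by positivity) h2 2
      nlinarith
    exact (abs_le_of_sq_le_sq' h3 (by positivity)).2
  · refine Real.le_sqrt_of_sq_le ?_
    nlinarith [sq_nonneg (t - 1)]

theorem lintegral_sectorRadius {c : ℝ} (hc : 0 < c) (hc1 : c < 1) (m : ℕ) :
    ∫⁻ t in Set.Icc (0 : ℝ) 1, ENNReal.ofReal (sectorRadius c t) ^ m ≤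
      ENNReal.ofReal (√(1 - c ^ 2) ^ m * c / (m + 1)
        + (2 - 2 * c) ^ ((m : ℝ) / 2 + 1) / (m + 2)) := by
  have hI1 : ∫⁻ t in Set.Ioc 0 c, ENNReal.ofReal (sectorRadius c t) ^ m =
      ENNReal.ofReal (√(1 - c ^ 2) ^ m * c / (m + 1)) := by
    have h1 : ∫ t in Set.Ioc 0 c, (√(1 - c ^ 2) / c * t) ^ m = √(1 - c ^ 2) ^ m * c / (m + 1) := by
      rw [← intervalIntegral.integral_of_le hc.le]
      simp only [mul_pow, intervalIntegral.integral_const_mul, integral_pow]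
      field_simp
      simp only [ne_eq, Nat.add_eq_zero_iff, one_ne_zero, and_false, not_false_eq_true, zero_pow,
        sub_zero]
      rw [div_pow]
      field_simp
      ring
    rw [← h1, ofReal_integral_eq_lintegral_ofReal]
    · refine setLIntegral_congr_fun measurableSet_Ioc fun t ht => ?_
      have : 0 ≤ √(1 - c ^ 2) / c * t := mul_nonneg (by positivity) ht.1.le
      simp only [sectorRadius, if_pos ht.2]
      rw [ENNReal.ofReal_pow this]
    · exact (Continuous.integrableOn_Icc (by fun_prop)).mono_set Set.Ioc_subset_Icc_self
    · filter_upwards [self_mem_ae_restrict measurableSet_Ioc] with t ht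
      have : 0 ≤ √(1 - c ^ 2) / c * t := mul_nonneg (by positivity) ht.1.le
      positivity
  have hI2 : ∫⁻ t in Set.Ioc c 1, ENNReal.ofReal (sectorRadius c t) ^ m =
      ENNReal.ofReal ((2 - 2 * c) ^ ((m : ℝ) / 2 + 1) / (m + 2)) := by
    have h1 : ∫ t in Set.Ioc c 1, √(2 - 2 * t) ^ m
        = (2 - 2 * c) ^ ((m : ℝ) / 2 + 1) / (m + 2) := by
      rw [← intervalIntegral.integral_of_le hc1.le]
      have h2 := intervalIntegral.integral_comp_sub_mul (a := c) (b := 1) (fun x : ℝ => √x ^ m)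
        (c := 2) two_ne_zero 2
      rw [h2]
      have h3 : ∀ x ∈ Set.uIcc (2 - 2 * 1) (2 - 2 * c), √x ^ m = x ^ ((m : ℝ) / 2) := by
        intro x hx
        rw [Set.uIcc_of_le (by linarith)] at hx
        have hx0 : 0 ≤ x := by linarith [hx.1]
        rw [Real.sqrt_eq_rpow, ← Real.rpow_natCast, ← Real.rpow_mul hx0]
        congr 1
        ring
      rw [intervalIntegral.integral_congr h3, integral_rpow (Or.inl (by
        have : (0 : ℝ) ≤ m := by positivity
        linarith))]
      norm_num
      rw [Real.zero_rpow (by positivity)]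
      field_simp
      ring
    rw [← h1, ofReal_integral_eq_lintegral_ofReal]
    · refine setLIntegral_congr_fun measurableSet_Ioc fun t ht => ?_
      simp only [sectorRadius, if_neg (not_le.2 ht.1)]
      rw [ENNReal.ofReal_pow (by positivity)]
    · exact (Continuous.integrableOn_Icc (by fun_prop)).mono_set Set.Ioc_subset_Icc_self
    · filter_upwards with t
      positivity
  rw [setLIntegral_congr Ioc_ae_eq_Icc.symm, ← Set.Ioc_union_Ioc_eq_Ioc hc.le hc1.le]
  refine (lintegral_union_le _ _ _).trans ?_
  have : 0 ≤ 2 - 2 * c := by linarith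
  rw [hI1, hI2, ← ENNReal.ofReal_add (by positivity) (by positivity)]

theorem volume_ballSector_le {m : ℕ} (hm : 0 < m) {c : ℝ} (hc : 0 < c) (hc1 : c < 1)
    (u : EuclideanSpace ℝ (Fin (m + 1))) (hu : ‖u‖ = 1) :
    volume (ballSector c u) ≤ ENNReal.ofReal ((√(1 - c ^ 2) ^ m * c / (m + 1)
        + (2 - 2 * c) ^ ((m : ℝ) / 2 + 1) / (m + 2)) * unitBallVolume m) := by
  obtain ⟨φ, hφ⟩ := exists_linearIsometryEquiv_prod u hu
  have hmeas : MeasurableSet (ballSector c u) :=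
    ((isClosed_le (f := fun x : EuclideanSpace ℝ (Fin (m + 1)) => ‖x‖) (g := fun _ => 1)
      (by fun_prop) (by fun_prop)).inter (isClosed_le (f := fun x => c * ‖x‖)
      (g := fun x => inner ℝ u x) (by fun_prop) (by fun_prop))).measurableSet
  have : Nonempty (Fin m) := ⟨⟨0, hm⟩⟩
  have hmp := φ.measurePreserving.comp
    (WithLp.volume_preserving_toLp ℝ (EuclideanSpace ℝ (Fin m)))
  rw [← hmp.measure_preimage hmeas.nullMeasurableSet, Measure.volume_eq_prod,
    Measure.prod_apply (hmp.measurable hmeas)]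
  have hslice : ∀ t : ℝ, Prod.mk t ⁻¹' ((φ ∘ WithLp.toLp 2) ⁻¹' ballSector c u) ⊆
      {y | t ∈ Set.Icc (0 : ℝ) 1 ∧ y ∈ Metric.closedBall 0 (sectorRadius c t)} := by
    intro t y hy
    have hn : ‖φ (WithLp.toLp 2 (t, y))‖ = √(t ^ 2 + ‖y‖ ^ 2) := by
      rw [φ.norm_map, WithLp.prod_norm_eq_of_L2]
      simp
    have hin : inner ℝ u (φ (WithLp.toLp 2 (t, y))) = t := by
      rw [← hφ, φ.inner_map_map, WithLp.prod_inner_apply]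
      simp
    have h1 : ‖φ (WithLp.toLp 2 (t, y))‖ ≤ 1 := hy.1
    have h2 : c * ‖φ (WithLp.toLp 2 (t, y))‖ ≤ inner ℝ u (φ (WithLp.toLp 2 (t, y))) := hy.2
    rw [hn] at h1 h2
    rw [hin] at h2
    have := sector_slice hc hc1 h1 h2
    exact ⟨this.1, by rw [mem_closedBall_zero_iff]; exact this.2⟩
  calc ∫⁻ t, volume (Prod.mk t ⁻¹' ((φ ∘ WithLp.toLp 2) ⁻¹' ballSector c u))
      ≤ ∫⁻ t, (Set.Icc (0 : ℝ) 1).indicator (fun t => ENNReal.ofReal (sectorRadius c t) ^ m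
          * ENNReal.ofReal (unitBallVolume m)) t := by
        refine lintegral_mono fun t => (measure_mono (hslice t)).trans ?_
        by_cases ht : t ∈ Set.Icc (0 : ℝ) 1
        · rw [Set.indicator_of_mem ht]
          simp only [ht, true_and]
          refine (EuclideanSpace.volume_closedBall (Fin m) 0 (sectorRadius c t)).le.trans ?_
          simp [unitBallVolume]
        · simp [ht]
    _ ≤ _ := by
        rw [lintegral_indicator measurableSet_Icc, lintegral_mul_const' _ _ ENNReal.ofReal_ne_top,
          ENNReal.ofReal_mul' (unitBallVolume_pos m).le]
        gcongr
        exact lintegral_sectorRadius hc hc1 m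

/-- Otherwise the N solid sectors would cover the unit ball, contradicting the volume estimate after
division by the volume of the m-dimensional unit ball. Solid sectors avoid surface measure. -/
theorem exists_inner_lt {m N : ℕ} (hm : 0 < m) {c : ℝ} (hc : 0 < c) (hc1 : c < 1)
    (u : Fin N → EuclideanSpace ℝ (Fin (m + 1))) (hu : ∀ k, ‖u k‖ = 1)
    (hN : N * (√(1 - c ^ 2) ^ m * c / (m + 1) + (2 - 2 * c) ^ ((m : ℝ) / 2 + 1) / (m + 2)) <
      √Real.pi * (Real.Gamma ((m : ℝ) / 2 + 1) / Real.Gamma ((m : ℝ) / 2 + 3 / 2))) :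
    ∃ x, ‖x‖ = 1 ∧ ∀ k, inner ℝ (u k) x < c := by
  by_contra! hcon
  have : Nonempty (Fin (m + 1)) := ⟨0⟩
  have hcover : Metric.closedBall (0 : EuclideanSpace ℝ (Fin (m + 1))) 1 ⊆
      ⋃ k, ballSector c (u k) := by
    intro x hx
    rw [mem_closedBall_zero_iff] at hx
    rw [Set.mem_iUnion]
    by_cases hx0 : x = 0
    · obtain ⟨k, -⟩ := hcon (EuclideanSpace.single 0 1) (by simp)
      exact ⟨k, by simp [ballSector, hx0]⟩
    · have hn : 0 < ‖x‖ := norm_pos_iff.2 hx0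
      obtain ⟨k, hk⟩ := hcon (‖x‖⁻¹ • x) (by
        rw [norm_smul, norm_inv, norm_norm, inv_mul_cancel₀ hn.ne'])
      refine ⟨k, hx, ?_⟩
      rw [inner_smul_right, inv_mul_eq_div, le_div_iff₀ hn] at hk
      exact hk
  have h0 : 0 ≤ √(1 - c ^ 2) ^ m * c / (m + 1) + (2 - 2 * c) ^ ((m : ℝ) / 2 + 1) / (m + 2) := by
    have : 0 ≤ 2 - 2 * c := by linarith
    positivity
  have hω := unitBallVolume_pos m
  have h1 : ENNReal.ofReal (unitBallVolume (m + 1)) ≤ ENNReal.ofReal (N * ((√(1 - c ^ 2) ^ m * c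
      / (m + 1) + (2 - 2 * c) ^ ((m : ℝ) / 2 + 1) / (m + 2)) * unitBallVolume m)) := by
    calc ENNReal.ofReal (unitBallVolume (m + 1))
        = volume (Metric.closedBall (0 : EuclideanSpace ℝ (Fin (m + 1))) 1) := by
          rw [EuclideanSpace.volume_closedBall]
          simp [unitBallVolume]
      _ ≤ ∑ k, volume (ballSector c (u k)) :=
          (measure_mono hcover).trans (measure_iUnion_fintype_le _ _)
      _ ≤ ∑ k : Fin N, ENNReal.ofReal ((√(1 - c ^ 2) ^ m * c / (m + 1)
          + (2 - 2 * c) ^ ((m : ℝ) / 2 + 1) / (m + 2)) * unitBallVolume m) :=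
          Finset.sum_le_sum fun k _ => volume_ballSector_le hm hc hc1 (u k) (hu k)
      _ = _ := by
          rw [Finset.sum_const, Finset.card_univ, Fintype.card_fin, nsmul_eq_mul,
            ENNReal.ofReal_mul (p := (N : ℝ)) (by positivity), ENNReal.ofReal_natCast]
  rw [ENNReal.ofReal_le_ofReal_iff (by positivity), unitBallVolume_succ, ← mul_assoc] at h1
  exact absurd (le_of_mul_le_mul_right h1 hω) (not_le.2 hN)

theorem sector_mul_lt {m : ℕ} (hm : 2 ≤ m) {q : ℝ} (hq : 0 < q) (hq2 : q < 2 - √2) {N : ℝ}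
    (hN0 : 0 ≤ N) (hN : N < capCount m 1 (q / 2)) :
    N * (√(1 - (1 - q / 2) ^ 2) ^ m * (1 - q / 2) / (m + 1) + q ^ ((m : ℝ) / 2 + 1) / (m + 2)) <
      √Real.pi * (Real.Gamma ((m : ℝ) / 2 + 1) / Real.Gamma ((m : ℝ) / 2 + 3 / 2)) := by
  have hm' : (2 : ℝ) ≤ m := by exact_mod_cast hm
  set G := √Real.pi * (Real.Gamma ((m : ℝ) / 2 + 1) / Real.Gamma ((m : ℝ) / 2 + 3 / 2)) with hG
  have hG0 : 0 < G := by
    have h1 : 0 < Real.Gamma ((m : ℝ) / 2 + 1) := Real.Gamma_pos_of_pos (by positivity)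
    have h2 : 0 < Real.Gamma ((m : ℝ) / 2 + 3 / 2) := Real.Gamma_pos_of_pos (by positivity)
    positivity
  have hs2 : (1.414 : ℝ) < √2 := by
    apply Real.lt_sqrt_of_sq_lt
    norm_num
  have hq3 : q < 0.586 := by linarith
  have hcap : capCount m 1 (q / 2) = ((m : ℝ) ^ 2 - 1) / m * G / q ^ (((m : ℝ) - 1) / 2) := by
    rw [capCount, hG, show (1 : ℝ) / (2 * (q / 2)) = q⁻¹ by field_simp, Real.inv_rpow hq.le]
    ring
  have hΦ : √(1 - (1 - q / 2) ^ 2) ^ m * (1 - q / 2) / (m + 1) + q ^ ((m : ℝ) / 2 + 1) / (m + 2)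
      ≤ q ^ (((m : ℝ) - 1) / 2) / (m + 1) := by
    have h1 : √(1 - (1 - q / 2) ^ 2) ^ m ≤ √q ^ m := by
      gcongr
      nlinarith
    have h2 : √q ^ m = √q * q ^ (((m : ℝ) - 1) / 2) := by
      rw [Real.sqrt_eq_rpow, ← Real.rpow_natCast, ← Real.rpow_mul hq.le, ← Real.rpow_add hq]
      congr 1
      ring
    have h3 : q ^ ((m : ℝ) / 2 + 1) = √q * q * q ^ (((m : ℝ) - 1) / 2) := by
      rw [Real.sqrt_eq_rpow, ← Real.rpow_add_one hq.ne', ← Real.rpow_add hq]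
      congr 1
      ring
    -- This is where small depth, q < 2 - √2, is needed: it absorbs the part of the sector beyond
    -- the cone.
    have h4 : √q * (1 + q / 2) ≤ 1 := by
      have h5 : √q ≤ 0.766 := by
        rw [Real.sqrt_le_left (by norm_num)]
        linarith
      nlinarith [Real.sqrt_nonneg q]
    set p := q ^ (((m : ℝ) - 1) / 2)
    have hp : 0 < p := Real.rpow_pos_of_pos hq _
    have hsq := Real.sqrt_nonneg q
    calc √(1 - (1 - q / 2) ^ 2) ^ m * (1 - q / 2) / (m + 1) + q ^ ((m : ℝ) / 2 + 1) / (m + 2)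
        ≤ √q * p * (1 - q / 2) / (m + 1) + √q * q * p / (m + 1) := by
          rw [← h2, h3]
          gcongr
          · linarith
          · linarith
      _ = (√q * (1 + q / 2)) * (p / (m + 1)) := by ring
      _ ≤ 1 * (p / (m + 1)) := by gcongr
      _ = p / (m + 1) := one_mul _
  rw [hcap, lt_div_iff₀ (Real.rpow_pos_of_pos hq _)] at hN
  calc N * (√(1 - (1 - q / 2) ^ 2) ^ m * (1 - q / 2) / (m + 1) + q ^ ((m : ℝ) / 2 + 1) / (m + 2))
      ≤ N * (q ^ (((m : ℝ) - 1) / 2) / (m + 1)) := by gcongr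
    _ = (N * q ^ (((m : ℝ) - 1) / 2)) / (m + 1) := by ring
    _ < (((m : ℝ) ^ 2 - 1) / m * G) / (m + 1) := by gcongr
    _ ≤ G := by
        rw [div_le_iff₀ (by positivity), div_mul_eq_mul_div, div_le_iff₀ (by positivity)]
        nlinarith

/-- Greedy choice: while fewer than `capCount` points are present, another fits. The `+ 1` in the
hypothesis lets the number of points be the ceiling of `capCount`. -/
theorem exists_unit_separated {m : ℕ} (hm : 2 ≤ m) {q : ℝ} (hq : 0 < q) (hq2 : q < 2 - √2) (N : ℕ)
    (hN : (N : ℝ) < capCount m 1 (q / 2) + 1) :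
    ∃ u : Fin N → EuclideanSpace ℝ (Fin (m + 1)), (∀ k, ‖u k‖ = 1) ∧
      ∀ j k, j ≠ k → inner ℝ (u j) (u k) < 1 - q / 2 := by
  induction N with
  | zero => exact ⟨Fin.elim0, fun k => k.elim0, fun k => k.elim0⟩
  | succ N ih =>
    push_cast at hN
    obtain ⟨u, hu, hsep⟩ := ih (by linarith)
    have hs2 := Real.sqrt_nonneg 2
    have hN2 := sector_mul_lt hm hq hq2 (N := N) (by positivity) (by linarith)
    obtain ⟨x, hx, hux⟩ := exists_inner_lt (m := m) (by omega) (c := 1 - q / 2) (by linarith)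
      (by linarith) u hu (by rwa [show 2 - 2 * (1 - q / 2) = q by ring])
    refine ⟨Fin.cons x u, ?_, ?_⟩
    · intro k
      cases k using Fin.cases with
      | zero => simpa using hx
      | succ k => simpa using hu k
    · intro j k hjk
      cases j using Fin.cases with
      | zero =>
        cases k using Fin.cases with
        | zero => exact absurd rfl hjk
        | succ k =>
          rw [real_inner_comm]
          simpa using hux k
      | succ j =>
        cases k using Fin.cases with
        | zero => simpa using hux j
        | succ k => simpa using hsep j k fun h => hjk (by rw [h])

theorem isCapPacking_of_unit {d K : ℕ} {R β : ℝ} (hR : 0 < R) (hβ : 0 < β)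
    {u : Fin K → EuclideanSpace ℝ (Fin d)} (hu : ∀ k, ‖u k‖ = 1)
    (hsep : ∀ j k, j ≠ k → inner ℝ (u j) (u k) < 1 - β / R)
    (hcard : β < (1 - √2 / 2) * R → capCount ((d : ℝ) - 1) R β ≤ K) :
    IsCapPacking R β fun k => R • u k where
  injective := by
    intro j k hjk
    by_contra hne
    have h1 := hsep j k hne
    have h2 : u j = u k := smul_right_injective _ hR.ne' hjk
    rw [h2, real_inner_self_eq_norm_sq, hu] at h1
    have : 0 < β / R := by positivity
    linarith
  norm_eq k := by rw [norm_smul, hu, mul_one, Real.norm_of_nonneg hR.le]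
  cap_inter k := by
    ext y
    constructor
    · rintro ⟨⟨-, hy⟩, j, rfl⟩
      by_contra hne
      have h1 := hsep j k fun h => hne (by simp [h])
      simp only [← smul_sub, inner_smul_left, inner_smul_right, inner_sub_left,
        real_inner_self_eq_norm_sq, hu, conj_trivial] at hy
      have h2 : β / R * R = β := div_mul_cancel₀ _ hR.ne'
      have h3 : R * (inner ℝ (u j) (u k) - 1) < -β := by nlinarith
      nlinarith
    · rintro rfl
      refine ⟨⟨?_, ?_⟩, k, rfl⟩
      · rw [norm_smul, hu, mul_one, Real.norm_of_nonneg hR.le]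
      · rw [sub_self, inner_zero_left]
        nlinarith
  card_ge := hcard

theorem capCount_eq (m R β : ℝ) : capCount m R β = capCount m 1 (β / R) := by
  rw [capCount, capCount]
  congr 2
  rw [one_div, ← mul_div_assoc, inv_div]

theorem capCount_pos {m R β : ℝ} (hm : 1 < m) (hR : 0 < R) (hβ : 0 < β) : 0 < capCount m R β := by
  have h1 : 0 < Real.Gamma (m / 2 + 1) := Real.Gamma_pos_of_pos (by positivity)
  have h2 : 0 < Real.Gamma (m / 2 + 3 / 2) := Real.Gamma_pos_of_pos (by positivity)
  have h3 : 0 < m ^ 2 - 1 := by nlinarith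
  have := Real.pi_pos
  unfold capCount
  positivity

theorem exists_capPacking {d : ℕ} (hd : 3 ≤ d) {R β : ℝ} (hR : 0 < R) (hβ : 0 < β)
    (hβR : β < (1 - √2 / 2) * R) :
    ∃ (K : ℕ) (w : Fin K → EuclideanSpace ℝ (Fin d)), 0 < K ∧ IsCapPacking R β w := by
  obtain ⟨m, rfl⟩ : ∃ m, d = m + 1 := ⟨d - 1, by omega⟩
  have hm : (2 : ℝ) ≤ m := by exact_mod_cast (show 2 ≤ m by omega)
  have hq2 : 2 * (β / R) < 2 - √2 := by
    have : β / R < 1 - √2 / 2 := by rwa [div_lt_iff₀ hR]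
    linarith
  have hpos := capCount_pos (m := m) (by linarith) one_pos (div_pos hβ hR)
  obtain ⟨u, hu, hsep⟩ := exists_unit_separated (m := m) (by omega) (q := 2 * (β / R))
    (by positivity) hq2 ⌈capCount m 1 (β / R)⌉₊ (by
      rw [mul_div_cancel_left₀ _ two_ne_zero]
      exact Nat.ceil_lt_add_one hpos.le)
  rw [mul_div_cancel_left₀ _ two_ne_zero] at hsep
  refine ⟨_, _, Nat.ceil_pos.2 hpos, isCapPacking_of_unit hR hβ hu hsep fun _ => ?_⟩
  rw [Nat.cast_add_one, add_sub_cancel_right, capCount_eq]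
  exact Nat.le_ceil _

/-! ### The dimensional constant, the choice of the data and the conclusion. -/

/-- Upper bound for the ratio of the volumes of the unit balls of dimensions `d` and `d - 1`. -/
theorem sqrt_pi_mul_Gamma_ratio_le {d : ℕ} (hd : 3 ≤ d) :
    √Real.pi * (Real.Gamma ((d : ℝ) / 2 + 1 / 2) / Real.Gamma ((d : ℝ) / 2 + 1)) ≤
      ((d : ℝ) + 1) / d := by
  have hπ : 0 < √Real.pi := Real.sqrt_pos.2 Real.pi_pos
  have h52 : Real.Gamma (5 / 2) = 3 / 4 * √Real.pi := by
    rw [show (5 / 2 : ℝ) = 1 / 2 + 1 + 1 by norm_num, Real.Gamma_add_one (by norm_num),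
      Real.Gamma_add_one (by norm_num), Real.Gamma_one_half_eq]
    ring
  induction d using Nat.strong_induction_on with
  | _ d ih =>
    -- The Gamma recursion moves d by 2, hence two base cases: equality for d = 3, and 3π/8 ≤ 5/4
    -- for d = 4.
    obtain rfl | rfl | h5 : d = 3 ∨ d = 4 ∨ 5 ≤ d := by omega
    · norm_num
      rw [h52]
      field_simp
      norm_num
    · norm_num
      rw [h52]
      have := Real.mul_self_sqrt Real.pi_pos.le
      have := Real.pi_lt_d2
      nlinarith
    · obtain ⟨e, rfl⟩ : ∃ e, d = e + 2 := ⟨d - 2, by omega⟩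
      have h := ih e (by omega) (by omega)
      have he : (3 : ℝ) ≤ e := by exact_mod_cast (show 3 ≤ e by omega)
      have h1 : ((e + 2 : ℕ) : ℝ) / 2 + 1 / 2 = ((e : ℝ) / 2 + 1 / 2) + 1 := by push_cast; ring
      have h2 : ((e + 2 : ℕ) : ℝ) / 2 + 1 = ((e : ℝ) / 2 + 1) + 1 := by push_cast; ring
      rw [h1, h2, Real.Gamma_add_one (by positivity), Real.Gamma_add_one (by positivity)]
      push_cast
      calc √Real.pi * (((e : ℝ) / 2 + 1 / 2) * Real.Gamma ((e : ℝ) / 2 + 1 / 2) /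
            (((e : ℝ) / 2 + 1) * Real.Gamma ((e : ℝ) / 2 + 1)))
          = (((e : ℝ) / 2 + 1 / 2) / ((e : ℝ) / 2 + 1)) * (√Real.pi *
            (Real.Gamma ((e : ℝ) / 2 + 1 / 2) / Real.Gamma ((e : ℝ) / 2 + 1))) := by
            rw [mul_div_mul_comm]
            ring
        _ ≤ (((e : ℝ) / 2 + 1 / 2) / ((e : ℝ) / 2 + 1)) * (((e : ℝ) + 1) / e) := by gcongr
        _ ≤ ((e : ℝ) + 2 + 1) / (e + 2) := by
            rw [div_mul_div_comm, div_le_div_iff₀ (by positivity) (by positivity)]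
            nlinarith

/-- The dimensional constant of the iteration lower bound. -/
noncomputable def iterConst (d : ℕ) : ℝ :=
  ((d : ℝ) * ((d : ℝ) - 2) * √Real.pi / ((d : ℝ) - 1)) *
    (Real.Gamma ((d : ℝ) / 2 + 1 / 2) / Real.Gamma ((d : ℝ) / 2 + 1))

theorem iterConst_nonneg {d : ℕ} (hd : 3 ≤ d) : 0 ≤ iterConst d := by
  have hd' : (3 : ℝ) ≤ d := by exact_mod_cast hd
  have h1 : 0 < Real.Gamma ((d : ℝ) / 2 + 1 / 2) := Real.Gamma_pos_of_pos (by positivity)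
  have h2 : 0 < Real.Gamma ((d : ℝ) / 2 + 1) := Real.Gamma_pos_of_pos (by positivity)
  have h3 : 0 < (d : ℝ) - 2 := by linarith
  have h4 : 0 < (d : ℝ) - 1 := by linarith
  unfold iterConst
  positivity

theorem iterConst_le {d : ℕ} (hd : 3 ≤ d) : iterConst d ≤ d := by
  have hd' : (3 : ℝ) ≤ d := by exact_mod_cast hd
  have h3 : 0 < (d : ℝ) - 2 := by linarith
  have h4 : 0 < (d : ℝ) - 1 := by linarith
  have h := sqrt_pi_mul_Gamma_ratio_le hd
  calc iterConst d = ((d : ℝ) * ((d : ℝ) - 2) / ((d : ℝ) - 1)) * (√Real.pi *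
        (Real.Gamma ((d : ℝ) / 2 + 1 / 2) / Real.Gamma ((d : ℝ) / 2 + 1))) := by
        unfold iterConst
        ring
    _ ≤ ((d : ℝ) * ((d : ℝ) - 2) / ((d : ℝ) - 1)) * (((d : ℝ) + 1) / d) := by gcongr
    _ ≤ d := by
        rw [div_mul_div_comm, div_le_iff₀ (by positivity)]
        nlinarith

theorem capCount_sub_one (d : ℕ) (R β : ℝ) :
    capCount ((d : ℝ) - 1) R β = iterConst d * (R / (2 * β)) ^ (((d : ℝ) - 2) / 2) := by
  unfold capCount iterConst
  rw [show ((d : ℝ) - 1) / 2 + 1 = (d : ℝ) / 2 + 1 / 2 by ring,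
    show ((d : ℝ) - 1) / 2 + 3 / 2 = (d : ℝ) / 2 + 1 by ring,
    show ((d : ℝ) - 1 - 1) / 2 = ((d : ℝ) - 2) / 2 by ring]
  ring

theorem natCast_mul_pow_le {d : ℕ} (hd : 3 ≤ d) : (d : ℝ) * (2 / 3) ^ (d - 2) ≤ 2 := by
  induction d, hd using Nat.le_induction with
  | base => norm_num
  | succ d hd ih =>
    have hd' : (3 : ℝ) ≤ d := by exact_mod_cast hd
    have hp : (0 : ℝ) < (2 / 3) ^ (d - 2) := by positivity
    rw [show d + 1 - 2 = d - 2 + 1 by omega, pow_succ]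
    push_cast
    nlinarith

/-- A packing that is large enough for the iteration lower bound, for every cap depth. -/
theorem exists_capPacking_bound {d : ℕ} (hd : 3 ≤ d) {R β X : ℝ} (hR : 0 < R) (hβ : 0 < β)
    (hX0 : 0 ≤ X) (hX : 7 * X * β ≤ 2 * R) :
    ∃ (K : ℕ) (w : Fin K → EuclideanSpace ℝ (Fin d)), 0 < K ∧ IsCapPacking R β w ∧
      (iterConst d * X ^ (((d : ℝ) - 2) / 2) < 3 ∨ iterConst d * X ^ (((d : ℝ) - 2) / 2) ≤ K) := by
  have hd' : (3 : ℝ) ≤ d := by exact_mod_cast hd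
  have hc0 := iterConst_nonneg hd
  have hcd := iterConst_le hd
  have hp : 0 ≤ ((d : ℝ) - 2) / 2 := by linarith
  have hs2 : (1.414 : ℝ) < √2 := by
    apply Real.lt_sqrt_of_sq_lt
    norm_num
  have hs3 : √2 < 1.415 := by
    rw [Real.sqrt_lt' (by norm_num)]
    norm_num
  by_cases h1 : β < (1 - √2 / 2) * R
  · obtain ⟨K, w, hK, hw⟩ := exists_capPacking hd hR hβ h1
    refine ⟨K, w, hK, hw, Or.inr (le_trans ?_ (hw.card_ge h1))⟩
    rw [capCount_sub_one]
    gcongr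
    rw [le_div_iff₀ (by positivity)]
    nlinarith [mul_nonneg hX0 hβ.le]
  by_cases h2 : β < R
  -- Medium depth: inner products 0 of an orthonormal basis are below 1 - β/R, and X ≤ 2R/(7β) < 1
  -- reduces the target to `iterConst_le`.
  · have hu : ∀ k : Fin d, ‖EuclideanSpace.single k (1 : ℝ)‖ = 1 := by simp
    have hR' : β / R < 1 := by rwa [div_lt_one hR]
    refine ⟨d, _, by omega, isCapPacking_of_unit hR hβ hu (fun j k hjk => ?_) (fun h => absurd h h1),
      Or.inr ?_⟩
    · rw [EuclideanSpace.inner_single_left]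
      simp [hjk, hR']
    · have hX1 : X ≤ 1 := by
        by_contra! hcon
        nlinarith
      have := Real.rpow_le_one hX0 hX1 hp
      nlinarith
  -- Depth at least R: a single point. Now X ≤ 2/7 makes the target less than 3, which n ≥ 1 will
  -- cover.
  · have hu : ∀ k : Fin 1, ‖EuclideanSpace.single (⟨0, by omega⟩ : Fin d) (1 : ℝ)‖ = 1 := by simp
    refine ⟨1, _, one_pos, isCapPacking_of_unit hR hβ hu
      (fun j k hjk => absurd (Subsingleton.elim j k) hjk) (fun h => absurd h h1), Or.inl ?_⟩
    have hX1 : X ≤ (2 / 3) ^ 2 := by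
      by_contra! hcon
      nlinarith
    have h3 : X ^ (((d : ℝ) - 2) / 2) ≤ (2 / 3) ^ (d - 2) := by
      refine (Real.rpow_le_rpow hX0 hX1 hp).trans (le_of_eq ?_)
      rw [← Real.rpow_natCast, ← Real.rpow_natCast, ← Real.rpow_mul (by norm_num),
        Nat.cast_sub (by omega)]
      congr 1
      push_cast
      ring
    calc iterConst d * X ^ (((d : ℝ) - 2) / 2) ≤ d * (2 / 3) ^ (d - 2) := by gcongr
      _ ≤ 2 := natCast_mul_pow_le hd
      _ < 3 := by norm_num

theorem exists_sphericalCapExample {d T : ℕ} {L D ε : ℝ} (hd : 3 ≤ d) (hT : 2 ≤ T) (hL : 0 < L)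
    (hD : 0 < D) (hε : 0 < ε) :
    ∃ S : SphericalCapExample d T L D ε, ∀ t, 1 ≤ t → t < T →
      iterConst d * (D * L * ((T : ℝ) - 1) / (8 * ε)) ^ (((d : ℝ) - 2) / 2) < 3 ∨
      iterConst d * (D * L * ((T : ℝ) - 1) / (8 * ε)) ^ (((d : ℝ) - 2) / 2) ≤ S.K t := by
  have hT' : (2 : ℝ) ≤ T := by exact_mod_cast hT
  have hT1 : 0 < (T : ℝ) - 1 := by linarith
  set X := D * L * ((T : ℝ) - 1) / (8 * ε) with hX
  -- Strictly decreasing and at least 7L/8 up to stage T. This is stronger than L/2 and gives the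
  -- factor 7 in `exists_capPacking_bound`, whose slack treats the medium depths.
  set lip : ℕ → ℝ := fun t => L * (1 - t / (8 * T)) with hlip
  have hlip78 : ∀ t, t ≤ T → 7 / 8 * L ≤ lip t := by
    intro t ht
    have ht' : (t : ℝ) ≤ T := by exact_mod_cast ht
    have h1 : (t : ℝ) / (8 * T) ≤ 1 / 8 := by
      rw [div_le_div_iff₀ (by positivity) (by norm_num)]
      linarith
    simp only [hlip]
    nlinarith
  have key : ∀ t : ℕ, ∃ q : Σ K : ℕ, Fin K → EuclideanSpace ℝ (Fin d), (t = T → q.1 = 1) ∧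
      (1 ≤ t → t < T → 0 < q.1 ∧ IsCapPacking (D / 2) (ε / (((T : ℝ) - 1) * lip (t + 1))) q.2 ∧
        (iterConst d * X ^ (((d : ℝ) - 2) / 2) < 3 ∨
          iterConst d * X ^ (((d : ℝ) - 2) / 2) ≤ q.1)) := by
    intro t
    by_cases ht : t < T
    · have h78 := hlip78 (t + 1) ht
      have hl : 0 < lip (t + 1) := by linarith
      obtain ⟨K, w, h1, h2, h3⟩ := exists_capPacking_bound hd (R := D / 2)
        (β := ε / (((T : ℝ) - 1) * lip (t + 1))) (X := X) (by positivity) (by positivity)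
        (by positivity) (by
          have : 7 * X * (ε / (((T : ℝ) - 1) * lip (t + 1))) = D * ((7 / 8 * L) / lip (t + 1)) := by
            rw [hX]
            field_simp
          rw [this]
          have h4 : 7 / 8 * L / lip (t + 1) ≤ 1 := by rwa [div_le_one hl]
          nlinarith)
      exact ⟨⟨K, w⟩, fun h => absurd h ht.ne, fun _ _ => ⟨h1, h2, h3⟩⟩
    · exact ⟨⟨1, fun _ => 0⟩, fun _ => rfl, fun _ h => absurd h ht⟩
  choose q hq1 hq2 using key
  refine ⟨{
    lip := lip
    lip_one_le := ?_
    le_lip_last := ?_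
    lip_lt := ?_
    K := fun t => (q t).1
    K_pos := fun t h1 h2 => (hq2 t h1 h2).1
    K_last := hq1 T rfl
    w := fun t => (q t).2
    packing := fun t h1 h2 => (hq2 t h1 h2).2.1
    v := fun _ _ => 3 / 4 * (ε / ((T : ℝ) - 1))
    v_mem := ?_ }, fun t h1 h2 => (hq2 t h1 h2).2.2⟩
  · have : 0 ≤ ((1 : ℕ) : ℝ) / (8 * T) := by positivity
    simp only [hlip]
    nlinarith
  · have := hlip78 T le_rfl
    linarith
  · intro t _ _
    simp only [hlip]
    have : (t : ℝ) / (8 * T) < ((t + 1 : ℕ) : ℝ) / (8 * T) := by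
      gcongr
      exact Nat.lt_succ_self t
    nlinarith
  · intro t _ _ k
    have h1 : ε / (2 * (T : ℝ) - 2) = 1 / 2 * (ε / ((T : ℝ) - 1)) := by
      rw [show 2 * (T : ℝ) - 2 = 2 * ((T : ℝ) - 1) by ring]
      field_simp
    have h2 : 0 < ε / ((T : ℝ) - 1) := by positivity
    rw [h1]
    constructor <;> linarith

theorem mainTheorem6 (d T : ℕ) (L D ε : ℝ) (hd : 3 ≤ d) (hT : 2 ≤ T) (hL : 0 < L) (hD : 0 < D)
    (hε : 0 < ε) :
    ∃ S : SphericalCapExample d T L D ε,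
      S.problem.IsConvex ∧ S.problem.HasLipschitzCosts S.lip ∧
      ∀ (n : ℕ) (r : S.problem.Run), r.IsRun S.regularization n →
        r.upper n - ((r.lower n : ℝ) : EReal) < (ε : EReal) →
          1 / 3 * ((d : ℝ) * ((d : ℝ) - 2) * √Real.pi / ((d : ℝ) - 1)) *
              (Real.Gamma ((d : ℝ) / 2 + 1 / 2) / Real.Gamma ((d : ℝ) / 2 + 1)) *
              (D * L * ((T : ℝ) - 1) / (8 * ε)) ^ (((d : ℝ) - 2) / 2) < (n : ℝ) := by
  obtain ⟨S, hS⟩ := exists_sphericalCapExample hd hT hL hD hε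
  refine ⟨S, S.problem_isConvex hL, S.problem_hasLipschitzCosts hD hL, fun n r hr hgap => ?_⟩
  obtain ⟨t, h1, h2, hK⟩ := SphericalCapExample.exists_card_lt_of_gap_lt hT hε hD hL hr hgap
  have hn : (1 : ℝ) ≤ n := by exact_mod_cast SphericalCapExample.pos_of_gap_lt hr hgap
  rw [mul_assoc (1 / 3 : ℝ), mul_assoc (1 / 3 : ℝ)]
  change 1 / 3 * (iterConst d * _) < _
  -- The bound is either below 1 ≤ n, or at most K_t/3 < n.
  rcases hS t h1 h2 with h | h <;> linarith
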